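/- Let $\mathcal C$ be a bicategory and $W$ a class of $1$-morphisms of $\mathcal C$ (associators and unitors of $\mathcal C$ are omitted below) satisfying: - (BF1) every identity $\mathrm{id}_A$ is in $W$; - (BF2) $W$ is closed under composition; - (BF3) for all $f:X\to Z$ and $v:Y\to Z$ with $v\in W$ there are $v':P\to X$ in $W$, $f':P\to Y$ and an invertible $\rho:f\circ v'\Rightarrow v\circ f'$; - (BF4) (a) for all $u:Y\to Z$ in $W$, $f^1,f^2:X\to Y$ and $\alpha:u\circ f^1\Rightarrow u\circ f^2$ there are $v:D\to X$ in $W$ and $\beta:f^1\circ v\Rightarrow f^2\circ v$ with $\alpha\circ v=u\circ\beta$; (b) if $\alpha$ is invertible, $\beta$ can be taken invertible; (c) if $(D,v,\beta)$ and $(D',v',\beta')$ are both as in (a), there are $t:E\to D$, $t':E\to D'$ and an invertible $\zeta:v\circ t\Rightarrow v'\circ t'$ such that $v\circ t\in W$ and $(\beta'\circ t')\cdot(f^1\circ\zeta)=(f^2\circ\zeta)\cdot(\beta\circ t)$; - (BF5) a $1$-morphism isomorphic to one in $W$ is in $W$. A *set of choices* $C(W)$ is a choice of data $(P,v',f',\rho)$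 as in (BF3) for every pair $(f,v)$ with $v\in W$. A *set of choices* $D(W)$ is a choice of data $(D,v,\beta)$ as in (BF4a), with $\beta$ invertible if $\alpha$ is, for every $(u,f^1,f^2,\alpha)$ with $u\in W$; we call it the chosen lift of $\alpha$ along $u$. Fix $C(W)$. The bicategory of fractions $\mathcal C[W^{-1}]$ has the following ingredients. - *Objects*: those of $\mathcal C$. *Morphisms* $A\to B$: triples $(A',w,f)$ with $w:A'\to A$ in $W$ and $f:A'\to B$; the identity of $A$ is $(A,\mathrm{id}_A,\mathrm{id}_A)$, and $(B',v,g)\circ(A',w,f)=(P,w\circ v',g\circ f')$, where $(P,v',f',\rho)$ is chosen by $C(W)$ for $(f,v)$. - *$2$-morphisms* $(A^1,w^1,f^1)\Rightarrow(A^2,w^2,f^2)$: classes $[A^3,v^1,v^2,\alpha,\beta]$ with $v^i:A^3\to A^i$, $w^1\circ v^1\in W$, $\alpha:w^1\circ v^1\Rightarrow w^2\circ v^2$ invertible and $\beta:f^1\circ v^1\Rightarrow f^2\circ v^2$. Here $(A^3,v^1,v^2,\alpha,\beta)$ and $(A'^3,v'^1,v'^2,\alpha',\beta')$ are identified if there are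 $z:E\to A^3$, $z':E\to A'^3$ with $w^1\circ v^1\circ z\in W$ and invertible $\sigma^1:v'^1\circ z'\Rightarrow v^1\circ z$, $\sigma^2:v^2\circ z\Rightarrow v'^2\circ z'$ such that $(w^2\circ\sigma^2)\cdot(\alpha\circ z)\cdot(w^1\circ\sigma^1)=\alpha'\circ z'$ and $(f^2\circ\sigma^2)\cdot(\beta\circ z)\cdot(f^1\circ\sigma^1)=\beta'\circ z'$. - *Identity $2$-morphisms and unitors*: the classes of the evident diagrams; for the unitors these are given by the squares of $C(W)$. - *Vertical composition*. For representatives $(A^3,v^1,v^2,\alpha,\beta)$ and $(A'^3,u^2,u^3,\gamma,\delta)$, take the square chosen by $C(W)$ for $(w^2\circ v^2,\,w^2\circ u^2)$ and the chosen lift of its $2$-morphism along $w^2$. This gives $t^1:E\to A^3$, $t^2:E\to A'^3$ and an invertible $\rho:v^2\circ t^1\Rightarrow u^2\circ t^2$. The composite is $[E,v^1\circ t^1,u^3\circ t^2,\alpha'',\beta'']$, where $\alpha''$ is the pasting of $\alpha,\rho,\gamma$ and $\beta''$ that of $\beta,\rho,\delta$. - *Associators* $\underline h\circ(\underline g\circ\underline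 f)\Rightarrow(\underline h\circ\underline g)\circ\underline f$, for $\underline f=(A',u,f)$, $\underline g=(B',v,g)$, $\underline h=(C',w,h)$. Let $(A'',u^1,f^1,\delta)$, $(A''',u^2,l,\sigma)$, $(B'',v^1,g^1,\xi)$, $(\bar A,u^3,f^2,\eta)$ be chosen by $C(W)$ for $(f,v)$, $(g\circ f^1,w)$, $(g,w)$, $(f,v\circ v^1)$. Take the square chosen for $(u^1\circ u^2,u^3)$, the chosen lift along $v$ of its pasting with $\delta^{-1}$ and $\eta$, and then the chosen lift along $w$ of the pasting of the latter with $\sigma^{-1}$ and $\xi$. This gives $u^4:E\to A'''$, $u^5:E\to\bar A$ and invertible $\gamma:u^1u^2u^4\Rightarrow u^3u^5$, $\omega:f^1u^2u^4\Rightarrow v^1f^2u^5$, $\rho:lu^4\Rightarrow g^1f^2u^5$ such that $v\circ\omega$ is the pasting of $\delta^{-1},\gamma,\eta$, and $w\circ\rho$ is the pasting of $\sigma^{-1},\omega,\xi$. The associator is $[E,u^4,u^5,u\circ\gamma,h\circ\rho]$. - *Whiskering $\Delta\circ\underline f$*, for $\underline f=(A',w,f):A\to B$ and $\Delta=[B^3,u^1,u^2,\alpha,\beta]:(B^1,v^1,g^1)\Rightarrow(B^2,v^2,g^2)$.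 For $m=1,2$ let $(P^m,w'^m,f'^m,\rho^m)$ be chosen by $C(W)$ for $(f,v^m)$. Take the square chosen for $(f,v^m\circ u^m)$, then the square chosen for its left leg and $w'^m$, and the chosen lift along $v^m$ of the resulting pasting; this gives $t^m:D^m\to P^m$, $h^m:D^m\to B^3$ and an invertible $\sigma^m:f'^m\circ t^m\Rightarrow u^m\circ h^m$. Next take the square chosen for $(w'^1\circ t^1,w'^2\circ t^2)$ and the chosen lift along $v^1\circ u^1$ of the pasting of $\sigma^1,\rho^1$, this square, $\rho^2,\sigma^2,\alpha$; this gives $t^3:E\to D^1$, $t^4:E\to D^2$ and invertible $\varphi:w'^1t^1t^3\Rightarrow w'^2t^2t^4$, $\delta:h^1t^3\Rightarrow h^2t^4$. Then $\Delta\circ\underline f=[E,t^1t^3,t^2t^4,w\circ\varphi,\beta']$, with $\beta'$ the pasting of $\sigma^1$, $\delta$, $\beta$ and $(\sigma^2)^{-1}$. - *Whiskering $\underline g\circ\Gamma$*, for $\Gamma=[A^3,v^1,v^2,\alpha,\beta]:(A^1,w^1,f^1)\Rightarrow(A^2,w^2,f^2)$ and $\underline g=(B',u,g)$. For $m=1,2$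 let $(P^m,u^m,f'^m,\rho^m)$ be chosen by $C(W)$ for $(f^m,u)$. Take the squares chosen for $(v^1,u^1)$ and $(v^2,u^2)$, the square chosen for their legs into $A^3$, and the chosen lift $\lambda$ along $u$ of the pasting of these with $\rho^1,\rho^2,\beta$. The $2$-morphism $\underline g\circ\Gamma$ is the class of the diagram with legs into $P^1,P^2$ so obtained, with first component the pasting of the three squares and $\alpha$, and second component $g\circ\lambda$. - *Horizontal composition*: for $\Gamma:\underline f^1\Rightarrow\underline f^2$ and $\Delta:\underline g^1\Rightarrow\underline g^2$, the vertical composite of $\underline g^1\circ\Gamma$ followed by $\Delta\circ\underline f^2$. **Theorem.** Let $(\mathcal C,W)$ satisfy (BF1)–(BF5) and fix a set of choices $C(W)$. For every set of choices $D(W)$ the operations above are well defined on $2$-morphisms (independent of the representatives), and all sets of choices $D(W)$ give literally the same identities, unitors, associators, vertical compositions, whiskerings and horizontal compositions; that is, they give the same bicategory $\mathcal C[W^{-1}]$, not merely equivalent ones, so that it depends only on $C(W)$. Moreover, the associators, vertical composites and whiskerings are represented by the above diagrams formed from *any* data of the same shape, whether or not chosen by $C(W)$ and $D(W)$. Here the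 squares used for composing morphisms remain those of $C(W)$; $\gamma,\omega,\rho$, respectively $\delta$, respectively $\lambda$, have to satisfy the stated pasting equations; and the composite of the first leg with the left leg of the source has to lie in $W$. -/

import Mathlib

/-!
Pronk's bicategory of fractions.  Mathlib writes composition in a bicategory in diagrammatic order:
`f ≫ g` is the composite usually written `g ∘ f`, `f ◁ η` is `η ∘ f` and `η ▷ g` is `g ∘ η`.
The composition `η ⊗≫ θ` of 2-morphisms (and `≪⊗≫` of invertible ones) inserts the associators and
unitors of the ambient bicategory that are needed for `η` and `θ` to be composable.
-/

open CategoryTheory Bicategory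

universe w v u

namespace BiFrac

variable {K : Type u} [Bicategory.{w, v} K]

/-- A square `f ∘ fst ≅ v ∘ snd` whose leg `fst` lies in `W`. -/
structure OreSquare (W : MorphismProperty K) {X Y Z : K} (f : X ⟶ Z) (v : Y ⟶ Z) where
  pt : K
  fst : pt ⟶ X
  snd : pt ⟶ Y
  iso : fst ≫ f ≅ snd ≫ v
  fst_mem : W fst

/-- A morphism `v` in `W` and a 2-morphism `β : f₁ ∘ v ⇒ f₂ ∘ v` such that `α ∘ v = u ∘ β`. -/
structure CellLift (W : MorphismProperty K) {X Y Z : K} (u : Y ⟶ Z) (f₁ f₂ : X ⟶ Y)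
    (α : f₁ ≫ u ⟶ f₂ ≫ u) where
  pt : K
  v : pt ⟶ X
  v_mem : W v
  β : v ≫ f₁ ⟶ v ≫ f₂
  fac : v ◁ α = 𝟙 (v ≫ f₁ ≫ u) ⊗≫ β ▷ u ⊗≫ 𝟙 (v ≫ f₂ ≫ u)

/-- The axioms of a (right) bicalculus of fractions. -/
structure BF (W : MorphismProperty K) : Prop where
  bf1 : ∀ X : K, W (𝟙 X)
  bf2 : ∀ {X Y Z : K} (f : X ⟶ Y) (g : Y ⟶ Z), W f → W g → W (f ≫ g)
  bf3 : ∀ {X Y Z : K} (f : X ⟶ Z) (v : Y ⟶ Z), W v → Nonempty (OreSquare W f v)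
  /-- Parts (a) and (b) of the fourth axiom. -/
  bf4ab : ∀ {X Y Z : K} (u : Y ⟶ Z), W u → ∀ (f₁ f₂ : X ⟶ Y) (α : f₁ ≫ u ⟶ f₂ ≫ u),
    ∃ L : CellLift W u f₁ f₂ α, IsIso α → IsIso L.β
  /-- Part (c) of the fourth axiom. -/
  bf4c : ∀ {X Y Z : K} (u : Y ⟶ Z), W u → ∀ (f₁ f₂ : X ⟶ Y) (α : f₁ ≫ u ⟶ f₂ ≫ u)
    (L L' : CellLift W u f₁ f₂ α),
    ∃ (E : K) (t : E ⟶ L.pt) (t' : E ⟶ L'.pt) (ζ : t ≫ L.v ≅ t' ≫ L'.v),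
      W (t ≫ L.v) ∧
      ζ.hom ▷ f₁ ⊗≫ t' ◁ L'.β ⊗≫ 𝟙 ((t' ≫ L'.v) ≫ f₂) =
        𝟙 ((t ≫ L.v) ≫ f₁) ⊗≫ t ◁ L.β ⊗≫ ζ.hom ▷ f₂
  bf5 : ∀ {X Y : K} (f g : X ⟶ Y), W g → Nonempty (f ≅ g) → W f

/-- The choices `C(W)`: a square for every pair `(f, v)` with `v` in `W`. -/
structure CChoices (W : MorphismProperty K) where
  square : ∀ {X Y Z : K} (f : X ⟶ Z) (v : Y ⟶ Z), W v → OreSquare W f v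

/-- The choices `D(W)`: a lift, as in the fourth axiom, of every 2-morphism
`α : u ∘ f₁ ⇒ u ∘ f₂` with `u` in `W`, invertible when `α` is. -/
structure DChoices (W : MorphismProperty K) where
  lift : ∀ {X Y Z : K} (u : Y ⟶ Z), W u → ∀ (f₁ f₂ : X ⟶ Y) (α : f₁ ≫ u ⟶ f₂ ≫ u),
    CellLift W u f₁ f₂ α
  isIso_lift : ∀ {X Y Z : K} (u : Y ⟶ Z) (hu : W u) (f₁ f₂ : X ⟶ Y) (α : f₁ ≫ u ⟶ f₂ ≫ u),
    IsIso α → IsIso (lift u hu f₁ f₂ α).β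

/-- The 2-morphism of a lift as an isomorphism, when it is invertible. -/
noncomputable abbrev CellLift.isoβ {W : MorphismProperty K} {X Y Z : K} {u : Y ⟶ Z}
    {f₁ f₂ : X ⟶ Y} {α : f₁ ≫ u ⟶ f₂ ≫ u} (L : CellLift W u f₁ f₂ α) (hL : IsIso L.β) :
    L.v ≫ f₁ ≅ L.v ≫ f₂ :=
  @asIso _ _ _ _ L.β hL

/-! ### Morphisms and 2-morphisms -/

/-- A morphism `A ⟶ B` of the bicategory of fractions: `A ⟵ pt ⟶ B` with left leg in `W`. -/
structure Frac (W : MorphismProperty K) (A B : K) where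
  pt : K
  w : pt ⟶ A
  f : pt ⟶ B
  w_mem : W w

/-- A representative of a 2-morphism between two morphisms of the bicategory of fractions. -/
structure Rep {W : MorphismProperty K} {A B : K} (F₁ F₂ : Frac W A B) where
  pt : K
  v₁ : pt ⟶ F₁.pt
  v₂ : pt ⟶ F₂.pt
  α : v₁ ≫ F₁.w ≅ v₂ ≫ F₂.w
  β : v₁ ≫ F₁.f ⟶ v₂ ≫ F₂.f
  mem : W (v₁ ≫ F₁.w)

/-- The relation under which two representatives define the same 2-morphism. -/
def Rep.Rel {W : MorphismProperty K} {A B : K} {F₁ F₂ : Frac W A B} (r r' : Rep F₁ F₂) : Prop :=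
  ∃ (E : K) (z : E ⟶ r.pt) (z' : E ⟶ r'.pt) (σ₁ : z' ≫ r'.v₁ ≅ z ≫ r.v₁)
    (σ₂ : z ≫ r.v₂ ≅ z' ≫ r'.v₂),
    W (z ≫ r.v₁ ≫ F₁.w) ∧
    σ₁.hom ▷ F₁.w ⊗≫ z ◁ r.α.hom ⊗≫ σ₂.hom ▷ F₂.w =
      𝟙 ((z' ≫ r'.v₁) ≫ F₁.w) ⊗≫ z' ◁ r'.α.hom ⊗≫ 𝟙 ((z' ≫ r'.v₂) ≫ F₂.w) ∧
    σ₁.hom ▷ F₁.f ⊗≫ z ◁ r.β ⊗≫ σ₂.hom ▷ F₂.f =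
      𝟙 ((z' ≫ r'.v₁) ≫ F₁.f) ⊗≫ z' ◁ r'.β ⊗≫ 𝟙 ((z' ≫ r'.v₂) ≫ F₂.f)

/-- The 2-morphisms of the bicategory of fractions. -/
def Cell {W : MorphismProperty K} {A B : K} (F₁ F₂ : Frac W A B) :=
  Quot (Rep.Rel (F₁ := F₁) (F₂ := F₂))

/-- The 2-morphism represented by `r`. -/
def Rep.cell {W : MorphismProperty K} {A B : K} {F₁ F₂ : Frac W A B} (r : Rep F₁ F₂) :
    Cell F₁ F₂ :=
  Quot.mk _ r

variable {W : MorphismProperty K}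

namespace BF

theorem mem_of_iso (hW : BF W) {X Y : K} {f g : X ⟶ Y} (e : f ≅ g) (hg : W g) : W f :=
  hW.bf5 f g hg ⟨e⟩

end BF

/-- The second leg composite of a representative also lies in `W`. -/
theorem Rep.mem₂ (hW : BF W) {A B : K} {F₁ F₂ : Frac W A B} (r : Rep F₁ F₂) : W (r.v₂ ≫ F₂.w) :=
  hW.mem_of_iso r.α.symm r.mem

/-- The identity of `A`. -/
abbrev idFrac (hW : BF W) (A : K) : Frac W A A where
  pt := A
  w := 𝟙 A
  f := 𝟙 A
  w_mem := hW.bf1 A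

/-- The square chosen by `C(W)` for composing `F` and `G`. -/
abbrev CChoices.sq (C : CChoices W) {X Y Z : K} (F : Frac W X Y) (G : Frac W Y Z) :
    OreSquare W F.f G.w :=
  C.square F.f G.w G.w_mem

/-- The composite `G ∘ F`. -/
abbrev compFrac (hW : BF W) (C : CChoices W) {X Y Z : K} (F : Frac W X Y) (G : Frac W Y Z) :
    Frac W X Z where
  pt := (C.sq F G).pt
  w := (C.sq F G).fst ≫ F.w
  f := (C.sq F G).snd ≫ G.f
  w_mem := hW.bf2 _ _ (C.sq F G).fst_mem F.w_mem

/-- The representative of an identity 2-morphism. -/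
def idRep (hW : BF W) {A B : K} (F : Frac W A B) : Rep F F where
  pt := F.pt
  v₁ := 𝟙 F.pt
  v₂ := 𝟙 F.pt
  α := Iso.refl _
  β := 𝟙 _
  mem := hW.bf2 _ _ (hW.bf1 _) F.w_mem

/-- The representative of the unitor `F ∘ id ⇒ F`. -/
def leftUnitorRep (hW : BF W) (C : CChoices W) {A B : K} (F : Frac W A B) :
    Rep (compFrac hW C (idFrac hW A) F) F where
  pt := (C.sq (idFrac hW A) F).pt
  v₁ := 𝟙 _
  v₂ := (C.sq (idFrac hW A) F).snd
  α := λ_ ((C.sq (idFrac hW A) F).fst ≫ 𝟙 A) ≪≫ (C.sq (idFrac hW A) F).iso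
  β := (λ_ ((C.sq (idFrac hW A) F).snd ≫ F.f)).hom
  mem := hW.bf2 _ _ (hW.bf1 _) (compFrac hW C (idFrac hW A) F).w_mem

/-- The representative of the unitor `id ∘ F ⇒ F`. -/
def rightUnitorRep (hW : BF W) (C : CChoices W) {A B : K} (F : Frac W A B) :
    Rep (compFrac hW C F (idFrac hW B)) F where
  pt := (C.sq F (idFrac hW B)).pt
  v₁ := 𝟙 _
  v₂ := (C.sq F (idFrac hW B)).fst
  α := λ_ ((C.sq F (idFrac hW B)).fst ≫ F.w)
  β := (λ_ ((C.sq F (idFrac hW B)).snd ≫ 𝟙 B)).hom ≫ (C.sq F (idFrac hW B)).iso.inv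
  mem := hW.bf2 _ _ (hW.bf1 _) (compFrac hW C F (idFrac hW B)).w_mem

/-! ### Vertical composition -/

/-- Data from which a representative of a vertical composite can be formed. The membership
condition holds whenever `t₁` lies in `W`. -/
structure VertFilling {A B : K} {F₁ F₂ F₃ : Frac W A B} (r : Rep F₁ F₂) (s : Rep F₂ F₃) where
  pt : K
  t₁ : pt ⟶ r.pt
  t₂ : pt ⟶ s.pt
  ρ : t₁ ≫ r.v₂ ≅ t₂ ≫ s.v₁
  mem : W ((t₁ ≫ r.v₁) ≫ F₁.w)

/-- The representative of the vertical composite given by a filling. -/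
def VertFilling.rep {A B : K} {F₁ F₂ F₃ : Frac W A B} {r : Rep F₁ F₂} {s : Rep F₂ F₃}
    (X : VertFilling r s) : Rep F₁ F₃ where
  pt := X.pt
  v₁ := X.t₁ ≫ r.v₁
  v₂ := X.t₂ ≫ s.v₂
  α := Iso.refl ((X.t₁ ≫ r.v₁) ≫ F₁.w) ≪⊗≫ whiskerLeftIso X.t₁ r.α ≪⊗≫
    whiskerRightIso X.ρ F₂.w ≪⊗≫ whiskerLeftIso X.t₂ s.α ≪⊗≫
    Iso.refl ((X.t₂ ≫ s.v₂) ≫ F₃.w)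
  β := 𝟙 ((X.t₁ ≫ r.v₁) ≫ F₁.f) ⊗≫ X.t₁ ◁ r.β ⊗≫ X.ρ.hom ▷ F₂.f ⊗≫ X.t₂ ◁ s.β ⊗≫
    𝟙 ((X.t₂ ≫ s.v₂) ≫ F₃.f)
  mem := X.mem

/-- The 2-morphism of a square over `(w² ∘ r.v₂, w² ∘ s.v₁)`, rebracketed. -/
def vertPasting {A B : K} {F₁ F₂ F₃ : Frac W A B} {r : Rep F₁ F₂} {s : Rep F₂ F₃}
    (q : OreSquare W (r.v₂ ≫ F₂.w) (s.v₁ ≫ F₂.w)) :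
    (q.fst ≫ r.v₂) ≫ F₂.w ≅ (q.snd ≫ s.v₁) ≫ F₂.w :=
  Iso.refl ((q.fst ≫ r.v₂) ≫ F₂.w) ≪⊗≫ q.iso ≪⊗≫ Iso.refl ((q.snd ≫ s.v₁) ≫ F₂.w)

/-- The filling given by such a square and a lift of its 2-morphism along `w²`. -/
noncomputable def VertFilling.ofLift (hW : BF W) {A B : K} {F₁ F₂ F₃ : Frac W A B}
    {r : Rep F₁ F₂} {s : Rep F₂ F₃} (q : OreSquare W (r.v₂ ≫ F₂.w) (s.v₁ ≫ F₂.w))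
    (L : CellLift W F₂.w (q.fst ≫ r.v₂) (q.snd ≫ s.v₁) (vertPasting q).hom) (hL : IsIso L.β) :
    VertFilling r s where
  pt := L.pt
  t₁ := L.v ≫ q.fst
  t₂ := L.v ≫ q.snd
  ρ := Iso.refl ((L.v ≫ q.fst) ≫ r.v₂) ≪⊗≫ L.isoβ hL ≪⊗≫ Iso.refl ((L.v ≫ q.snd) ≫ s.v₁)
  mem := hW.mem_of_iso (α_ _ _ _) (hW.bf2 _ _ (hW.bf2 _ _ L.v_mem q.fst_mem) r.mem)

/-- The filling determined by `C(W)` and `D(W)`: the square chosen for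
`(w² ∘ r.v₂, w² ∘ s.v₁)`, then the chosen lift of its 2-morphism along `w²`. -/
noncomputable def vertFilling (hW : BF W) (C : CChoices W) (D : DChoices W) {A B : K}
    {F₁ F₂ F₃ : Frac W A B} (r : Rep F₁ F₂) (s : Rep F₂ F₃) : VertFilling r s :=
  VertFilling.ofLift hW (C.square (r.v₂ ≫ F₂.w) (s.v₁ ≫ F₂.w) s.mem)
    (D.lift F₂.w F₂.w_mem _ _ _) (D.isIso_lift F₂.w F₂.w_mem _ _ _ inferInstance)

/-! ### Associators -/

/-- The square chosen by `C(W)` for composing `G ∘ F` with `H`. -/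
abbrev CChoices.sqL (C : CChoices W) {X Y Z T : K} (F : Frac W X Y) (G : Frac W Y Z)
    (H : Frac W Z T) : OreSquare W ((C.sq F G).snd ≫ G.f) H.w :=
  C.square ((C.sq F G).snd ≫ G.f) H.w H.w_mem

/-- The square chosen by `C(W)` for composing `F` with `H ∘ G`. -/
abbrev CChoices.sqR (C : CChoices W) (hW : BF W) {X Y Z T : K} (F : Frac W X Y) (G : Frac W Y Z)
    (H : Frac W Z T) : OreSquare W F.f ((C.sq G H).fst ≫ G.w) :=
  C.square F.f ((C.sq G H).fst ≫ G.w) (hW.bf2 _ _ (C.sq G H).fst_mem G.w_mem)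

/-- Data from which a representative of the associator `H ∘ (G ∘ F) ⇒ (H ∘ G) ∘ F` can be
formed. -/
structure AssocFilling (hW : BF W) (C : CChoices W) {X Y Z T : K} (F : Frac W X Y)
    (G : Frac W Y Z) (H : Frac W Z T) where
  pt : K
  u₄ : pt ⟶ (C.sqL F G H).pt
  u₅ : pt ⟶ (C.sqR hW F G H).pt
  γ : u₄ ≫ (C.sqL F G H).fst ≫ (C.sq F G).fst ≅ u₅ ≫ (C.sqR hW F G H).fst
  ω : u₄ ≫ (C.sqL F G H).fst ≫ (C.sq F G).snd ≅
    u₅ ≫ (C.sqR hW F G H).snd ≫ (C.sq G H).fst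
  ρ : u₄ ≫ (C.sqL F G H).snd ≅ u₅ ≫ (C.sqR hW F G H).snd ≫ (C.sq G H).snd
  mem : W (u₄ ≫ (C.sqL F G H).fst ≫ (C.sq F G).fst ≫ F.w)

/-- The two compatibility conditions on the data: `v ∘ ω` is the pasting of `δ⁻¹`, `γ`, `η`, and
`w ∘ ρ` is the pasting of `σ⁻¹`, `ω`, `ξ`, where `δ`, `σ`, `ξ`, `η` are the chosen squares. -/
structure AssocFilling.Valid {hW : BF W} {C : CChoices W} {X Y Z T : K} {F : Frac W X Y}
    {G : Frac W Y Z} {H : Frac W Z T} (P : AssocFilling hW C F G H) : Prop where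
  ω_eq : P.ω.hom ▷ G.w =
    𝟙 ((P.u₄ ≫ (C.sqL F G H).fst ≫ (C.sq F G).snd) ≫ G.w) ⊗≫
      (P.u₄ ≫ (C.sqL F G H).fst) ◁ (C.sq F G).iso.inv ⊗≫
      P.γ.hom ▷ F.f ⊗≫
      P.u₅ ◁ (C.sqR hW F G H).iso.hom ⊗≫
      𝟙 ((P.u₅ ≫ (C.sqR hW F G H).snd ≫ (C.sq G H).fst) ≫ G.w)
  ρ_eq : P.ρ.hom ▷ H.w =
    𝟙 ((P.u₄ ≫ (C.sqL F G H).snd) ≫ H.w) ⊗≫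
      P.u₄ ◁ (C.sqL F G H).iso.inv ⊗≫
      P.ω.hom ▷ G.f ⊗≫
      (P.u₅ ≫ (C.sqR hW F G H).snd) ◁ (C.sq G H).iso.hom ⊗≫
      𝟙 ((P.u₅ ≫ (C.sqR hW F G H).snd ≫ (C.sq G H).snd) ≫ H.w)

/-- The representative of the associator given by a filling. -/
def AssocFilling.rep {hW : BF W} {C : CChoices W} {X Y Z T : K} {F : Frac W X Y}
    {G : Frac W Y Z} {H : Frac W Z T} (P : AssocFilling hW C F G H) :
    Rep (compFrac hW C (compFrac hW C F G) H) (compFrac hW C F (compFrac hW C G H)) where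
  pt := P.pt
  v₁ := P.u₄
  v₂ := P.u₅
  α := Iso.refl (P.u₄ ≫ (C.sqL F G H).fst ≫ (C.sq F G).fst ≫ F.w) ≪⊗≫
    whiskerRightIso P.γ F.w ≪⊗≫ Iso.refl (P.u₅ ≫ (C.sqR hW F G H).fst ≫ F.w)
  β := 𝟙 (P.u₄ ≫ (C.sqL F G H).snd ≫ H.f) ⊗≫ P.ρ.hom ▷ H.f ⊗≫
    𝟙 (P.u₅ ≫ (C.sqR hW F G H).snd ≫ (C.sq G H).snd ≫ H.f)
  mem := P.mem

/-- The pasting of `δ⁻¹`, of a square `q` over `(u¹ ∘ u², u³)` and of `η`. -/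
def assocPasting₁ {hW : BF W} {C : CChoices W} {X Y Z T : K} {F : Frac W X Y} {G : Frac W Y Z}
    {H : Frac W Z T}
    (q : OreSquare W ((C.sqL F G H).fst ≫ (C.sq F G).fst) (C.sqR hW F G H).fst) :
    (q.fst ≫ (C.sqL F G H).fst ≫ (C.sq F G).snd) ≫ G.w ≅
      (q.snd ≫ (C.sqR hW F G H).snd ≫ (C.sq G H).fst) ≫ G.w :=
  Iso.refl ((q.fst ≫ (C.sqL F G H).fst ≫ (C.sq F G).snd) ≫ G.w) ≪⊗≫
    whiskerLeftIso (q.fst ≫ (C.sqL F G H).fst) (C.sq F G).iso.symm ≪⊗≫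
    whiskerRightIso q.iso F.f ≪⊗≫
    whiskerLeftIso q.snd (C.sqR hW F G H).iso ≪⊗≫
    Iso.refl ((q.snd ≫ (C.sqR hW F G H).snd ≫ (C.sq G H).fst) ≫ G.w)

/-- The pasting of `σ⁻¹`, of an isomorphism `ω` and of `ξ`. -/
def assocPasting₂ {hW : BF W} {C : CChoices W} {X Y Z T : K} {F : Frac W X Y} {G : Frac W Y Z}
    {H : Frac W Z T}
    (q : OreSquare W ((C.sqL F G H).fst ≫ (C.sq F G).fst) (C.sqR hW F G H).fst)
    {E : K} (z : E ⟶ q.pt)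
    (ω : z ≫ q.fst ≫ (C.sqL F G H).fst ≫ (C.sq F G).snd ≅
      z ≫ q.snd ≫ (C.sqR hW F G H).snd ≫ (C.sq G H).fst) :
    (z ≫ q.fst ≫ (C.sqL F G H).snd) ≫ H.w ≅
      (z ≫ q.snd ≫ (C.sqR hW F G H).snd ≫ (C.sq G H).snd) ≫ H.w :=
  Iso.refl ((z ≫ q.fst ≫ (C.sqL F G H).snd) ≫ H.w) ≪⊗≫
    whiskerLeftIso (z ≫ q.fst) (C.sqL F G H).iso.symm ≪⊗≫
    whiskerRightIso ω G.f ≪⊗≫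
    whiskerLeftIso (z ≫ q.snd ≫ (C.sqR hW F G H).snd) (C.sq G H).iso ≪⊗≫
    Iso.refl ((z ≫ q.snd ≫ (C.sqR hW F G H).snd ≫ (C.sq G H).snd) ≫ H.w)

/-- The filling given by a square `q` over `(u¹ ∘ u², u³)`, a lift of the first pasting along `v`
and a lift of the resulting second pasting along `w`. -/
noncomputable def AssocFilling.ofLifts {hW : BF W} {C : CChoices W} {X Y Z T : K}
    {F : Frac W X Y} {G : Frac W Y Z} {H : Frac W Z T}
    (q : OreSquare W ((C.sqL F G H).fst ≫ (C.sq F G).fst) (C.sqR hW F G H).fst)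
    (L : CellLift W G.w (q.fst ≫ (C.sqL F G H).fst ≫ (C.sq F G).snd)
      (q.snd ≫ (C.sqR hW F G H).snd ≫ (C.sq G H).fst) (assocPasting₁ q).hom)
    (hL : IsIso L.β)
    (M : CellLift W H.w (L.v ≫ q.fst ≫ (C.sqL F G H).snd)
      (L.v ≫ q.snd ≫ (C.sqR hW F G H).snd ≫ (C.sq G H).snd)
      (assocPasting₂ q L.v (L.isoβ hL)).hom)
    (hM : IsIso M.β) : AssocFilling hW C F G H where
  pt := M.pt
  u₄ := M.v ≫ L.v ≫ q.fst
  u₅ := M.v ≫ L.v ≫ q.snd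
  γ := Iso.refl ((M.v ≫ L.v ≫ q.fst) ≫ (C.sqL F G H).fst ≫ (C.sq F G).fst) ≪⊗≫
    whiskerLeftIso (M.v ≫ L.v) q.iso ≪⊗≫
    Iso.refl ((M.v ≫ L.v ≫ q.snd) ≫ (C.sqR hW F G H).fst)
  ω := Iso.refl ((M.v ≫ L.v ≫ q.fst) ≫ (C.sqL F G H).fst ≫ (C.sq F G).snd) ≪⊗≫
    whiskerLeftIso M.v (L.isoβ hL) ≪⊗≫
    Iso.refl ((M.v ≫ L.v ≫ q.snd) ≫ (C.sqR hW F G H).snd ≫ (C.sq G H).fst)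
  ρ := Iso.refl ((M.v ≫ L.v ≫ q.fst) ≫ (C.sqL F G H).snd) ≪⊗≫ M.isoβ hM ≪⊗≫
    Iso.refl ((M.v ≫ L.v ≫ q.snd) ≫ (C.sqR hW F G H).snd ≫ (C.sq G H).snd)
  mem := hW.bf2 _ _ (hW.bf2 _ _ M.v_mem (hW.bf2 _ _ L.v_mem q.fst_mem))
    (hW.bf2 _ _ (C.sqL F G H).fst_mem (hW.bf2 _ _ (C.sq F G).fst_mem F.w_mem))

/-- The filling determined by `C(W)` and `D(W)`: the square chosen for `(u¹ ∘ u², u³)` and the two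
chosen lifts. -/
noncomputable def assocFilling (hW : BF W) (C : CChoices W) (D : DChoices W) {X Y Z T : K}
    (F : Frac W X Y) (G : Frac W Y Z) (H : Frac W Z T) : AssocFilling hW C F G H :=
  AssocFilling.ofLifts
    (C.square ((C.sqL F G H).fst ≫ (C.sq F G).fst) (C.sqR hW F G H).fst
      (C.sqR hW F G H).fst_mem)
    (D.lift G.w G.w_mem _ _ _) (D.isIso_lift G.w G.w_mem _ _ _ inferInstance)
    (D.lift H.w H.w_mem _ _ _) (D.isIso_lift H.w H.w_mem _ _ _ inferInstance)

/-! ### Whiskering `Δ ∘ F` of a 2-morphism with a morphism that is composed first -/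

/-- Data from which a representative of `Δ ∘ F` can be formed, where `r` represents `Δ`. The
membership condition holds whenever `t₁` and `t₃` lie in `W`. -/
structure LeftFilling (C : CChoices W) {X Y Z : K} (F : Frac W X Y) {G₁ G₂ : Frac W Y Z}
    (r : Rep G₁ G₂) where
  D₃ : K
  t₁ : D₃ ⟶ (C.sq F G₁).pt
  h₁ : D₃ ⟶ r.pt
  σ₁ : t₁ ≫ (C.sq F G₁).snd ≅ h₁ ≫ r.v₁
  D₄ : K
  t₂ : D₄ ⟶ (C.sq F G₂).pt
  h₂ : D₄ ⟶ r.pt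
  σ₂ : t₂ ≫ (C.sq F G₂).snd ≅ h₂ ≫ r.v₂
  D₅ : K
  t₃ : D₅ ⟶ D₃
  t₄ : D₅ ⟶ D₄
  φ : t₃ ≫ t₁ ≫ (C.sq F G₁).fst ≅ t₄ ≫ t₂ ≫ (C.sq F G₂).fst
  δ : t₃ ≫ h₁ ≅ t₄ ≫ h₂
  mem : W ((t₃ ≫ t₁) ≫ (C.sq F G₁).fst ≫ F.w)

/-- The 2-morphism `δ` lifts the pasting of the other data along `v¹ ∘ u¹`. -/
def LeftFilling.Valid {C : CChoices W} {X Y Z : K} {F : Frac W X Y} {G₁ G₂ : Frac W Y Z}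
    {r : Rep G₁ G₂} (P : LeftFilling C F r) : Prop :=
  P.δ.hom ▷ (r.v₁ ≫ G₁.w) =
    𝟙 ((P.t₃ ≫ P.h₁) ≫ r.v₁ ≫ G₁.w) ⊗≫
      P.t₃ ◁ P.σ₁.inv ▷ G₁.w ⊗≫
      (P.t₃ ≫ P.t₁) ◁ (C.sq F G₁).iso.inv ⊗≫
      P.φ.hom ▷ F.f ⊗≫
      (P.t₄ ≫ P.t₂) ◁ (C.sq F G₂).iso.hom ⊗≫
      P.t₄ ◁ P.σ₂.hom ▷ G₂.w ⊗≫
      (P.t₄ ≫ P.h₂) ◁ r.α.inv ⊗≫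
      𝟙 ((P.t₄ ≫ P.h₂) ≫ r.v₁ ≫ G₁.w)

/-- The representative of `Δ ∘ F` given by a filling. -/
def LeftFilling.rep (hW : BF W) {C : CChoices W} {X Y Z : K} {F : Frac W X Y}
    {G₁ G₂ : Frac W Y Z} {r : Rep G₁ G₂} (P : LeftFilling C F r) :
    Rep (compFrac hW C F G₁) (compFrac hW C F G₂) where
  pt := P.D₅
  v₁ := P.t₃ ≫ P.t₁
  v₂ := P.t₄ ≫ P.t₂
  α := Iso.refl ((P.t₃ ≫ P.t₁) ≫ (C.sq F G₁).fst ≫ F.w) ≪⊗≫ whiskerRightIso P.φ F.w ≪⊗≫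
    Iso.refl ((P.t₄ ≫ P.t₂) ≫ (C.sq F G₂).fst ≫ F.w)
  β := 𝟙 ((P.t₃ ≫ P.t₁) ≫ (C.sq F G₁).snd ≫ G₁.f) ⊗≫
    P.t₃ ◁ P.σ₁.hom ▷ G₁.f ⊗≫
    P.δ.hom ▷ (r.v₁ ≫ G₁.f) ⊗≫
    (P.t₄ ≫ P.h₂) ◁ r.β ⊗≫
    P.t₄ ◁ P.σ₂.inv ▷ G₂.f ⊗≫
    𝟙 ((P.t₄ ≫ P.t₂) ≫ (C.sq F G₂).snd ≫ G₂.f)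
  mem := P.mem

/-- One half of the construction of `Δ ∘ F` from `C(W)` and `D(W)`: for `F`, `G` and a morphism
`x` with `G.w ∘ x` in `W`, a morphism `t` into the chosen composite, a morphism `h` and an
invertible `σ : f' ∘ t ⇒ x ∘ h`. -/
structure HalfFilling (C : CChoices W) {X Y Z : K} (F : Frac W X Y) (G : Frac W Y Z) {P : K}
    (x : P ⟶ G.pt) where
  pt : K
  t : pt ⟶ (C.sq F G).pt
  h : pt ⟶ P
  σ : t ≫ (C.sq F G).snd ≅ h ≫ x
  mem : W (t ≫ (C.sq F G).fst)

/-- The pasting of `ρ⁻¹`, `l⁻¹` and `τ`, where `ρ` is the square chosen for composing `F` and `G`,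
`τ` is a square over `(f, v ∘ x)` and `l` is a square over their legs into the source of `f`. -/
def halfPasting {C : CChoices W} {X Y Z : K} {F : Frac W X Y} {G : Frac W Y Z} {P : K}
    {x : P ⟶ G.pt} (τ : OreSquare W F.f (x ≫ G.w)) (l : OreSquare W τ.fst (C.sq F G).fst) :
    (l.snd ≫ (C.sq F G).snd) ≫ G.w ≅ (l.fst ≫ τ.snd ≫ x) ≫ G.w :=
  Iso.refl ((l.snd ≫ (C.sq F G).snd) ≫ G.w) ≪⊗≫
    whiskerLeftIso l.snd (C.sq F G).iso.symm ≪⊗≫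
    whiskerRightIso l.iso.symm F.f ≪⊗≫
    whiskerLeftIso l.fst τ.iso ≪⊗≫
    Iso.refl ((l.fst ≫ τ.snd ≫ x) ≫ G.w)

/-- The half filling given by such squares and a lift of their pasting along `v`. -/
noncomputable def HalfFilling.ofLift (hW : BF W) {C : CChoices W} {X Y Z : K} {F : Frac W X Y}
    {G : Frac W Y Z} {P : K} {x : P ⟶ G.pt} (τ : OreSquare W F.f (x ≫ G.w))
    (l : OreSquare W τ.fst (C.sq F G).fst)
    (L : CellLift W G.w (l.snd ≫ (C.sq F G).snd) (l.fst ≫ τ.snd ≫ x) (halfPasting τ l).hom)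
    (hL : IsIso L.β) : HalfFilling C F G x where
  pt := L.pt
  t := L.v ≫ l.snd
  h := L.v ≫ l.fst ≫ τ.snd
  σ := Iso.refl ((L.v ≫ l.snd) ≫ (C.sq F G).snd) ≪⊗≫ L.isoβ hL ≪⊗≫
    Iso.refl ((L.v ≫ l.fst ≫ τ.snd) ≫ x)
  mem := hW.mem_of_iso (α_ _ _ _ ≪≫ whiskerLeftIso L.v l.iso.symm)
    (hW.bf2 _ _ L.v_mem (hW.bf2 _ _ l.fst_mem τ.fst_mem))

/-- The half filling determined by `C(W)` and `D(W)`. -/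
noncomputable def halfFilling (hW : BF W) (C : CChoices W) (D : DChoices W) {X Y Z : K}
    (F : Frac W X Y) (G : Frac W Y Z) {P : K} (x : P ⟶ G.pt) (hx : W (x ≫ G.w)) :
    HalfFilling C F G x :=
  HalfFilling.ofLift hW (C.square F.f (x ≫ G.w) hx)
    (C.square (C.square F.f (x ≫ G.w) hx).fst (C.sq F G).fst (C.sq F G).fst_mem)
    (D.lift G.w G.w_mem _ _ _) (D.isIso_lift G.w G.w_mem _ _ _ inferInstance)

/-- The pasting that `δ` has to lift, for a square `q` over the legs of two half fillings. -/
def leftPasting {C : CChoices W} {X Y Z : K} {F : Frac W X Y} {G₁ G₂ : Frac W Y Z}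
    {r : Rep G₁ G₂} (m : HalfFilling C F G₁ r.v₁) (n : HalfFilling C F G₂ r.v₂)
    (q : OreSquare W (m.t ≫ (C.sq F G₁).fst) (n.t ≫ (C.sq F G₂).fst)) :
    (q.fst ≫ m.h) ≫ r.v₁ ≫ G₁.w ≅ (q.snd ≫ n.h) ≫ r.v₁ ≫ G₁.w :=
  Iso.refl ((q.fst ≫ m.h) ≫ r.v₁ ≫ G₁.w) ≪⊗≫
    whiskerLeftIso q.fst (whiskerRightIso m.σ.symm G₁.w) ≪⊗≫
    whiskerLeftIso (q.fst ≫ m.t) (C.sq F G₁).iso.symm ≪⊗≫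
    whiskerRightIso q.iso F.f ≪⊗≫
    whiskerLeftIso (q.snd ≫ n.t) (C.sq F G₂).iso ≪⊗≫
    whiskerLeftIso q.snd (whiskerRightIso n.σ G₂.w) ≪⊗≫
    whiskerLeftIso (q.snd ≫ n.h) r.α.symm ≪⊗≫
    Iso.refl ((q.snd ≫ n.h) ≫ r.v₁ ≫ G₁.w)

/-- The filling for `Δ ∘ F` given by two half fillings, a square over their legs and a lift of
the resulting pasting along `v¹ ∘ u¹`. -/
noncomputable def LeftFilling.ofLift (hW : BF W) {C : CChoices W} {X Y Z : K} {F : Frac W X Y}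
    {G₁ G₂ : Frac W Y Z} {r : Rep G₁ G₂} (m : HalfFilling C F G₁ r.v₁)
    (n : HalfFilling C F G₂ r.v₂)
    (q : OreSquare W (m.t ≫ (C.sq F G₁).fst) (n.t ≫ (C.sq F G₂).fst))
    (L : CellLift W (r.v₁ ≫ G₁.w) (q.fst ≫ m.h) (q.snd ≫ n.h) (leftPasting m n q).hom)
    (hL : IsIso L.β) : LeftFilling C F r where
  D₃ := m.pt
  t₁ := m.t
  h₁ := m.h
  σ₁ := m.σ
  D₄ := n.pt
  t₂ := n.t
  h₂ := n.h
  σ₂ := n.σ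
  D₅ := L.pt
  t₃ := L.v ≫ q.fst
  t₄ := L.v ≫ q.snd
  φ := Iso.refl ((L.v ≫ q.fst) ≫ m.t ≫ (C.sq F G₁).fst) ≪⊗≫ whiskerLeftIso L.v q.iso ≪⊗≫
    Iso.refl ((L.v ≫ q.snd) ≫ n.t ≫ (C.sq F G₂).fst)
  δ := Iso.refl ((L.v ≫ q.fst) ≫ m.h) ≪⊗≫ L.isoβ hL ≪⊗≫ Iso.refl ((L.v ≫ q.snd) ≫ n.h)
  mem := hW.mem_of_iso
    (Iso.refl (((L.v ≫ q.fst) ≫ m.t) ≫ (C.sq F G₁).fst ≫ F.w) ≪⊗≫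
      Iso.refl ((L.v ≫ q.fst) ≫ (m.t ≫ (C.sq F G₁).fst) ≫ F.w))
    (hW.bf2 _ _ (hW.bf2 _ _ L.v_mem q.fst_mem) (hW.bf2 _ _ m.mem F.w_mem))

/-- The filling for `Δ ∘ F` determined by `C(W)` and `D(W)`. -/
noncomputable def leftFilling (hW : BF W) (C : CChoices W) (D : DChoices W) {X Y Z : K}
    (F : Frac W X Y) {G₁ G₂ : Frac W Y Z} (r : Rep G₁ G₂) : LeftFilling C F r :=
  LeftFilling.ofLift hW (halfFilling hW C D F G₁ r.v₁ r.mem)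
    (halfFilling hW C D F G₂ r.v₂ (r.mem₂ hW))
    (C.square _ _ (halfFilling hW C D F G₂ r.v₂ (r.mem₂ hW)).mem)
    (D.lift (r.v₁ ≫ G₁.w) r.mem _ _ _)
    (D.isIso_lift (r.v₁ ≫ G₁.w) r.mem _ _ _ inferInstance)

/-! ### Whiskering `G ∘ Γ` of a 2-morphism with a morphism that is composed last -/

/-- Data from which a representative of `G ∘ Γ` can be formed, where `r` represents `Γ`. The
membership condition holds whenever `u₃` and `u₇` lie in `W`. -/
structure RightFilling (C : CChoices W) {X Y Z : K} {F₁ F₂ : Frac W X Y} (r : Rep F₁ F₂)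
    (G : Frac W Y Z) where
  D₃ : K
  u₃ : D₃ ⟶ r.pt
  u₄ : D₃ ⟶ (C.sq F₁ G).pt
  η₁ : u₃ ≫ r.v₁ ≅ u₄ ≫ (C.sq F₁ G).fst
  D₄ : K
  u₅ : D₄ ⟶ r.pt
  u₆ : D₄ ⟶ (C.sq F₂ G).pt
  η₂ : u₅ ≫ r.v₂ ≅ u₆ ≫ (C.sq F₂ G).fst
  D₅ : K
  u₇ : D₅ ⟶ D₃
  u₈ : D₅ ⟶ D₄
  η₃ : u₇ ≫ u₃ ≅ u₈ ≫ u₅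
  lam : u₇ ≫ u₄ ≫ (C.sq F₁ G).snd ⟶ u₈ ≫ u₆ ≫ (C.sq F₂ G).snd
  mem : W ((u₇ ≫ u₄) ≫ (C.sq F₁ G).fst ≫ F₁.w)

/-- The 2-morphism `lam` lifts the pasting of the other data along `u`. -/
def RightFilling.Valid {C : CChoices W} {X Y Z : K} {F₁ F₂ : Frac W X Y} {r : Rep F₁ F₂}
    {G : Frac W Y Z} (P : RightFilling C r G) : Prop :=
  P.lam ▷ G.w =
    𝟙 ((P.u₇ ≫ P.u₄ ≫ (C.sq F₁ G).snd) ≫ G.w) ⊗≫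
      (P.u₇ ≫ P.u₄) ◁ (C.sq F₁ G).iso.inv ⊗≫
      P.u₇ ◁ P.η₁.inv ▷ F₁.f ⊗≫
      P.η₃.hom ▷ (r.v₁ ≫ F₁.f) ⊗≫
      (P.u₈ ≫ P.u₅) ◁ r.β ⊗≫
      P.u₈ ◁ P.η₂.hom ▷ F₂.f ⊗≫
      (P.u₈ ≫ P.u₆) ◁ (C.sq F₂ G).iso.hom ⊗≫
      𝟙 ((P.u₈ ≫ P.u₆ ≫ (C.sq F₂ G).snd) ≫ G.w)

/-- The representative of `G ∘ Γ` given by a filling. -/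
def RightFilling.rep (hW : BF W) {C : CChoices W} {X Y Z : K} {F₁ F₂ : Frac W X Y}
    {r : Rep F₁ F₂} {G : Frac W Y Z} (P : RightFilling C r G) :
    Rep (compFrac hW C F₁ G) (compFrac hW C F₂ G) where
  pt := P.D₅
  v₁ := P.u₇ ≫ P.u₄
  v₂ := P.u₈ ≫ P.u₆
  α := Iso.refl ((P.u₇ ≫ P.u₄) ≫ (C.sq F₁ G).fst ≫ F₁.w) ≪⊗≫
    whiskerLeftIso P.u₇ (whiskerRightIso P.η₁.symm F₁.w) ≪⊗≫
    whiskerRightIso P.η₃ (r.v₁ ≫ F₁.w) ≪⊗≫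
    whiskerLeftIso (P.u₈ ≫ P.u₅) r.α ≪⊗≫
    whiskerLeftIso P.u₈ (whiskerRightIso P.η₂ F₂.w) ≪⊗≫
    Iso.refl ((P.u₈ ≫ P.u₆) ≫ (C.sq F₂ G).fst ≫ F₂.w)
  β := 𝟙 ((P.u₇ ≫ P.u₄) ≫ (C.sq F₁ G).snd ≫ G.f) ⊗≫ P.lam ▷ G.f ⊗≫
    𝟙 ((P.u₈ ≫ P.u₆) ≫ (C.sq F₂ G).snd ≫ G.f)
  mem := P.mem

/-- The pasting that `lam` has to lift, for squares `x₁` over `(v¹, u¹)`, `x₂` over `(v², u²)` and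
`x₃` over their legs into `A³`. -/
def rightPasting {C : CChoices W} {X Y Z : K} {F₁ F₂ : Frac W X Y} {r : Rep F₁ F₂}
    {G : Frac W Y Z} (x₁ : OreSquare W r.v₁ (C.sq F₁ G).fst)
    (x₂ : OreSquare W r.v₂ (C.sq F₂ G).fst) (x₃ : OreSquare W x₁.fst x₂.fst) :
    (x₃.fst ≫ x₁.snd ≫ (C.sq F₁ G).snd) ≫ G.w ⟶
      (x₃.snd ≫ x₂.snd ≫ (C.sq F₂ G).snd) ≫ G.w :=
  𝟙 ((x₃.fst ≫ x₁.snd ≫ (C.sq F₁ G).snd) ≫ G.w) ⊗≫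
    (x₃.fst ≫ x₁.snd) ◁ (C.sq F₁ G).iso.inv ⊗≫
    x₃.fst ◁ x₁.iso.inv ▷ F₁.f ⊗≫
    x₃.iso.hom ▷ (r.v₁ ≫ F₁.f) ⊗≫
    (x₃.snd ≫ x₂.fst) ◁ r.β ⊗≫
    x₃.snd ◁ x₂.iso.hom ▷ F₂.f ⊗≫
    (x₃.snd ≫ x₂.snd) ◁ (C.sq F₂ G).iso.hom ⊗≫
    𝟙 ((x₃.snd ≫ x₂.snd ≫ (C.sq F₂ G).snd) ≫ G.w)

/-- The filling for `G ∘ Γ` given by such squares and a lift of their pasting along `u`. -/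
def RightFilling.ofLift (hW : BF W) {C : CChoices W} {X Y Z : K} {F₁ F₂ : Frac W X Y}
    {r : Rep F₁ F₂} {G : Frac W Y Z} (x₁ : OreSquare W r.v₁ (C.sq F₁ G).fst)
    (x₂ : OreSquare W r.v₂ (C.sq F₂ G).fst) (x₃ : OreSquare W x₁.fst x₂.fst)
    (L : CellLift W G.w (x₃.fst ≫ x₁.snd ≫ (C.sq F₁ G).snd)
      (x₃.snd ≫ x₂.snd ≫ (C.sq F₂ G).snd) (rightPasting x₁ x₂ x₃)) : RightFilling C r G where
  D₃ := x₁.pt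
  u₃ := x₁.fst
  u₄ := x₁.snd
  η₁ := x₁.iso
  D₄ := x₂.pt
  u₅ := x₂.fst
  u₆ := x₂.snd
  η₂ := x₂.iso
  D₅ := L.pt
  u₇ := L.v ≫ x₃.fst
  u₈ := L.v ≫ x₃.snd
  η₃ := Iso.refl ((L.v ≫ x₃.fst) ≫ x₁.fst) ≪⊗≫ whiskerLeftIso L.v x₃.iso ≪⊗≫
    Iso.refl ((L.v ≫ x₃.snd) ≫ x₂.fst)
  lam := 𝟙 ((L.v ≫ x₃.fst) ≫ x₁.snd ≫ (C.sq F₁ G).snd) ⊗≫ L.β ⊗≫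
    𝟙 ((L.v ≫ x₃.snd) ≫ x₂.snd ≫ (C.sq F₂ G).snd)
  mem := hW.mem_of_iso
    (Iso.refl (((L.v ≫ x₃.fst) ≫ x₁.snd) ≫ (C.sq F₁ G).fst ≫ F₁.w) ≪⊗≫
      whiskerLeftIso (L.v ≫ x₃.fst) (whiskerRightIso x₁.iso.symm F₁.w) ≪⊗≫
      Iso.refl ((L.v ≫ x₃.fst) ≫ x₁.fst ≫ r.v₁ ≫ F₁.w))
    (hW.bf2 _ _ (hW.bf2 _ _ L.v_mem x₃.fst_mem) (hW.bf2 _ _ x₁.fst_mem r.mem))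

/-- The filling for `G ∘ Γ` determined by `C(W)` and `D(W)`. -/
def rightFilling (hW : BF W) (C : CChoices W) (D : DChoices W) {X Y Z : K}
    {F₁ F₂ : Frac W X Y} (r : Rep F₁ F₂) (G : Frac W Y Z) : RightFilling C r G :=
  RightFilling.ofLift hW (C.square r.v₁ (C.sq F₁ G).fst (C.sq F₁ G).fst_mem)
    (C.square r.v₂ (C.sq F₂ G).fst (C.sq F₂ G).fst_mem)
    (C.square _ _ (C.square r.v₂ (C.sq F₂ G).fst (C.sq F₂ G).fst_mem).fst_mem)
    (D.lift G.w G.w_mem _ _ _)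

/-! ### The bicategory of fractions -/

/-- The structure of a bicategory on the objects of `K`, the morphisms `Frac W`, the 2-morphisms
`Cell`, the identities `idFrac` and the composition `compFrac` of morphisms given by `C(W)`: the
remaining operations. Two bicategories of this kind are the same when these operations are. -/
@[ext]
structure Ops (hW : BF W) (C : CChoices W) where
  id₂ : ∀ {X Y : K} (F : Frac W X Y), Cell F F
  vcomp : ∀ {X Y : K} {F₁ F₂ F₃ : Frac W X Y}, Cell F₁ F₂ → Cell F₂ F₃ → Cell F₁ F₃
  whiskerLeft : ∀ {X Y Z : K} (F : Frac W X Y) {G₁ G₂ : Frac W Y Z}, Cell G₁ G₂ →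
    Cell (compFrac hW C F G₁) (compFrac hW C F G₂)
  whiskerRight : ∀ {X Y Z : K} {F₁ F₂ : Frac W X Y}, Cell F₁ F₂ → ∀ G : Frac W Y Z,
    Cell (compFrac hW C F₁ G) (compFrac hW C F₂ G)
  hcomp : ∀ {X Y Z : K} {F₁ F₂ : Frac W X Y} {G₁ G₂ : Frac W Y Z}, Cell F₁ F₂ → Cell G₁ G₂ →
    Cell (compFrac hW C F₁ G₁) (compFrac hW C F₂ G₂)
  associator : ∀ {X Y Z T : K} (F : Frac W X Y) (G : Frac W Y Z) (H : Frac W Z T),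
    Cell (compFrac hW C (compFrac hW C F G) H) (compFrac hW C F (compFrac hW C G H))
  leftUnitor : ∀ {X Y : K} (F : Frac W X Y), Cell (compFrac hW C (idFrac hW X) F) F
  rightUnitor : ∀ {X Y : K} (F : Frac W X Y), Cell (compFrac hW C F (idFrac hW Y)) F

/-- `S` is the structure of the bicategory of fractions constructed with the choices `C(W)` and
`D(W)`; each operation on 2-morphisms is computed on arbitrary representatives. -/
structure Ops.IsConstructed {hW : BF W} {C : CChoices W} (S : Ops hW C) (D : DChoices W) :
    Prop where
  id₂_eq : ∀ {X Y : K} (F : Frac W X Y), S.id₂ F = (idRep hW F).cell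
  vcomp_eq : ∀ {X Y : K} {F₁ F₂ F₃ : Frac W X Y} (r : Rep F₁ F₂) (s : Rep F₂ F₃),
    S.vcomp r.cell s.cell = (vertFilling hW C D r s).rep.cell
  whiskerLeft_eq : ∀ {X Y Z : K} (F : Frac W X Y) {G₁ G₂ : Frac W Y Z} (r : Rep G₁ G₂),
    S.whiskerLeft F r.cell = ((leftFilling hW C D F r).rep hW).cell
  whiskerRight_eq : ∀ {X Y Z : K} {F₁ F₂ : Frac W X Y} (r : Rep F₁ F₂) (G : Frac W Y Z),
    S.whiskerRight r.cell G = ((rightFilling hW C D r G).rep hW).cell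
  hcomp_eq : ∀ {X Y Z : K} {F₁ F₂ : Frac W X Y} {G₁ G₂ : Frac W Y Z} (Φ : Cell F₁ F₂)
    (Ψ : Cell G₁ G₂), S.hcomp Φ Ψ = S.vcomp (S.whiskerRight Φ G₁) (S.whiskerLeft F₂ Ψ)
  associator_eq : ∀ {X Y Z T : K} (F : Frac W X Y) (G : Frac W Y Z) (H : Frac W Z T),
    S.associator F G H = (assocFilling hW C D F G H).rep.cell
  leftUnitor_eq : ∀ {X Y : K} (F : Frac W X Y), S.leftUnitor F = (leftUnitorRep hW C F).cell
  rightUnitor_eq : ∀ {X Y : K} (F : Frac W X Y), S.rightUnitor F = (rightUnitorRep hW C F).cell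

/-- Associators, vertical compositions and whiskerings of `S` are represented by the diagrams
built from any admissible data whatsoever, whether or not these come from choices `D(W)`. -/
structure Ops.IsChoiceFree {hW : BF W} {C : CChoices W} (S : Ops hW C) : Prop where
  vcomp_eq : ∀ {X Y : K} {F₁ F₂ F₃ : Frac W X Y} (r : Rep F₁ F₂) (s : Rep F₂ F₃)
    (P : VertFilling r s), S.vcomp r.cell s.cell = P.rep.cell
  whiskerLeft_eq : ∀ {X Y Z : K} (F : Frac W X Y) {G₁ G₂ : Frac W Y Z} (r : Rep G₁ G₂)
    (P : LeftFilling C F r), P.Valid → S.whiskerLeft F r.cell = (P.rep hW).cell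
  whiskerRight_eq : ∀ {X Y Z : K} {F₁ F₂ : Frac W X Y} (r : Rep F₁ F₂) (G : Frac W Y Z)
    (P : RightFilling C r G), P.Valid → S.whiskerRight r.cell G = (P.rep hW).cell
  associator_eq : ∀ {X Y Z T : K} (F : Frac W X Y) (G : Frac W Y Z) (H : Frac W Z T)
    (P : AssocFilling hW C F G H), P.Valid → S.associator F G H = P.rep.cell

end BiFrac

/-!
Postcomposition with a morphism of `W` is fully faithful on 2-morphisms after restriction along
morphisms of `W`: this is the content of (BF4), and by cancellation it also holds for the first
legs of representatives. Hence two diagrams of the same shape become isomorphic after refining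
their apices. Their first legs can be matched by (BF3); each further leg, and each 2-morphism that
is required to lift a given pasting, is determined by that pasting up to a further refinement.

The relation that defines 2-morphisms is generated by restriction of a representative along a
morphism into its apex, and the data from which vertical composites and whiskerings are formed can
be transported along such restrictions. This gives independence of the representatives. As the
squares and lifts given by `C(W)` and `D(W)` are a particular instance of the data, it also gives
independence of `D(W)`.
-/

namespace BiFrac

variable {K : Type u} [Bicategory.{w, v} K] {W : MorphismProperty K}

/-! ### Extension and restriction of 2-morphisms between composites -/

section Extend

variable {E E' S T U Y Z : K} {a : E ⟶ S} {b : E ⟶ T} {c : E ⟶ U} {x : S ⟶ Y} {y : T ⟶ Y}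
  {z : U ⟶ Y}

/-- Whiskering of `θ : a ≫ x ⟶ b ≫ y` with `g`, rebracketed so that the legs `a` and `b` out of
the apex stay apart from the morphisms that follow them. -/
def extend (θ : a ≫ x ⟶ b ≫ y) (g : Y ⟶ Z) : a ≫ x ≫ g ⟶ b ≫ y ≫ g :=
  (α_ a x g).inv ≫ θ ▷ g ≫ (α_ b y g).hom

theorem whiskerRight_eq_extend (θ : a ≫ x ⟶ b ≫ y) (g : Y ⟶ Z) :
    θ ▷ g = (α_ a x g).hom ≫ extend θ g ≫ (α_ b y g).inv := by
  simp [extend]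

theorem extend_comp (θ : a ≫ x ⟶ b ≫ y) (χ : b ≫ y ⟶ c ≫ z) (g : Y ⟶ Z) :
    extend (θ ≫ χ) g = extend θ g ≫ extend χ g := by
  simp [extend]

theorem extend_whiskerLeft (a : E ⟶ S) {x x' : S ⟶ Y} (χ : x ⟶ x') (g : Y ⟶ Z) :
    extend (a ◁ χ) g = a ◁ χ ▷ g := by
  simp [extend]

/-- The extension of an invertible 2-morphism. -/
@[simps]
def extendIso (θ : a ≫ x ≅ b ≫ y) (g : Y ⟶ Z) : a ≫ x ≫ g ≅ b ≫ y ≫ g where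
  hom := extend θ.hom g
  inv := extend θ.inv g
  hom_inv_id := by rw [← extend_comp, θ.hom_inv_id]; simp [extend]
  inv_hom_id := by rw [← extend_comp, θ.inv_hom_id]; simp [extend]

theorem extend_hom_inv_assoc (θ : a ≫ x ≅ b ≫ y) (g : Y ⟶ Z) {c : E ⟶ Z} (χ : a ≫ x ≫ g ⟶ c) :
    extend θ.hom g ≫ extend θ.inv g ≫ χ = χ :=
  (extendIso θ g).hom_inv_id_assoc χ

theorem extend_inv_hom_assoc (θ : a ≫ x ≅ b ≫ y) (g : Y ⟶ Z) {c : E ⟶ Z} (χ : b ≫ y ≫ g ⟶ c) :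
    extend θ.inv g ≫ extend θ.hom g ≫ χ = χ :=
  (extendIso θ g).inv_hom_id_assoc χ

/-- The restriction of an isomorphism between composites along a morphism `d` into their source. -/
@[simps!]
def restrictIso (d : E' ⟶ E) (θ : a ≫ x ≅ b ≫ y) : (d ≫ a) ≫ x ≅ (d ≫ b) ≫ y :=
  α_ d a x ≪≫ whiskerLeftIso d θ ≪≫ (α_ d b y).symm

theorem extend_restrictIso_hom (d : E' ⟶ E) (θ : a ≫ x ≅ b ≫ y) (g : Y ⟶ Z) :
    extend (restrictIso d θ).hom g =
      (α_ d a (x ≫ g)).hom ≫ d ◁ extend θ.hom g ≫ (α_ d b (y ≫ g)).inv := by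
  simp [extend]

end Extend

/-! ### Intertwining isomorphisms -/

section Intertwines

variable {E E' Q Q' S T U Y Z : K} {e : E ⟶ Q} {e' : E ⟶ Q'} {a : Q ⟶ S} {a' : Q' ⟶ S}
  {b : Q ⟶ T} {b' : Q' ⟶ T} {c : Q ⟶ U} {c' : Q' ⟶ U}
  {κ : e ≫ a ≅ e' ≫ a'} {μ : e ≫ b ≅ e' ≫ b'} {ν : e ≫ c ≅ e' ≫ c'}
  {x : S ⟶ Y} {y : T ⟶ Y} {z : U ⟶ Y}

/-- The isomorphisms `κ` and `μ` between restrictions of the legs of `θ` and `θ'` to a common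
refinement `E` identify the restrictions of `θ` and `θ'`. -/
def Intertwines (κ : e ≫ a ≅ e' ≫ a') (μ : e ≫ b ≅ e' ≫ b') (θ : a ≫ x ⟶ b ≫ y)
    (θ' : a' ≫ x ⟶ b' ≫ y) : Prop :=
  extend κ.hom x ≫ e' ◁ θ' = e ◁ θ ≫ extend μ.hom y

theorem intertwines_iff {θ : a ≫ x ⟶ b ≫ y} {θ' : a' ≫ x ⟶ b' ≫ y} :
    Intertwines κ μ θ θ' ↔ κ.inv ▷ x ⊗≫ e ◁ θ ⊗≫ μ.hom ▷ y =
      𝟙 ((e' ≫ a') ≫ x) ⊗≫ e' ◁ θ' ⊗≫ 𝟙 ((e' ≫ b') ≫ y) := by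
  have left : κ.inv ▷ x ⊗≫ e ◁ θ ⊗≫ μ.hom ▷ y =
      κ.inv ▷ x ≫ (α_ _ _ _).hom ≫ (e ◁ θ ≫ extend μ.hom y) ≫ (α_ _ _ _).inv := by
    unfold extend; bicategory
  have right : 𝟙 ((e' ≫ a') ≫ x) ⊗≫ e' ◁ θ' ⊗≫ 𝟙 ((e' ≫ b') ≫ y) =
      κ.inv ▷ x ≫ (α_ _ _ _).hom ≫ (extend κ.hom x ≫ e' ◁ θ') ≫ (α_ _ _ _).inv := by
    simp [extend, bicategoricalComp]
  rw [left, right, cancel_epi, cancel_epi, cancel_mono, eq_comm, Intertwines]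

theorem intertwines_restrictIso_iff {θ : a ≫ x ⟶ b ≫ y} {θ' : a' ≫ x ⟶ b' ≫ y} {d : E' ⟶ E} :
    Intertwines (restrictIso d κ) (restrictIso d μ) θ θ' ↔
      d ◁ (extend κ.hom x ≫ e' ◁ θ') = d ◁ (e ◁ θ ≫ extend μ.hom y) := by
  simp [Intertwines, extend_restrictIso_hom, -restrictIso_hom]

theorem intertwines_extend_iff {θ : a ≫ x ⟶ b ≫ y} {θ' : a' ≫ x ⟶ b' ≫ y} {g : Y ⟶ Z} :
    Intertwines κ μ (extend θ g) (extend θ' g) ↔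
      (extend κ.hom x ≫ e' ◁ θ') ▷ g = (e ◁ θ ≫ extend μ.hom y) ▷ g := by
  have left : extend κ.hom (x ≫ g) ≫ e' ◁ extend θ' g =
      e ◁ (α_ a x g).inv ≫ (α_ e (a ≫ x) g).inv ≫ (extend κ.hom x ≫ e' ◁ θ') ▷ g ≫
        (α_ e' (b' ≫ y) g).hom ≫ e' ◁ (α_ b' y g).hom := by
    unfold extend; bicategory
  have right : e ◁ extend θ g ≫ extend μ.hom (y ≫ g) =
      e ◁ (α_ a x g).inv ≫ (α_ e (a ≫ x) g).inv ≫ (e ◁ θ ≫ extend μ.hom y) ▷ g ≫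
        (α_ e' (b' ≫ y) g).hom ≫ e' ◁ (α_ b' y g).hom := by
    unfold extend; bicategory
  rw [Intertwines, left, right, cancel_epi, cancel_epi, cancel_mono]

namespace Intertwines

theorem comp {θ : a ≫ x ⟶ b ≫ y} {θ' : a' ≫ x ⟶ b' ≫ y} {χ : b ≫ y ⟶ c ≫ z}
    {χ' : b' ≫ y ⟶ c' ≫ z} (h : Intertwines κ μ θ θ') (h' : Intertwines μ ν χ χ') :
    Intertwines κ ν (θ ≫ χ) (θ' ≫ χ') := by
  unfold Intertwines at *
  simp only [Bicategory.whiskerLeft_comp, Category.assoc, reassoc_of% h, h']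

theorem inv {θ : a ≫ x ≅ b ≫ y} {θ' : a' ≫ x ≅ b' ≫ y} (h : Intertwines κ μ θ.hom θ'.hom) :
    Intertwines μ κ θ.inv θ'.inv := by
  unfold Intertwines at *
  rw [← cancel_epi (e ◁ θ.hom), ← reassoc_of% h, whiskerLeft_hom_inv, whiskerLeft_hom_inv_assoc,
    Category.comp_id]

theorem whiskerLeft (κ : e ≫ a ≅ e' ≫ a') {x x' : S ⟶ Y} (χ : x ⟶ x') :
    Intertwines κ κ (a ◁ χ) (a' ◁ χ) := by
  calc
    _ = (α_ e a x).inv ≫ (κ.hom ▷ x ≫ (e' ≫ a') ◁ χ) ≫ (α_ e' a' x').hom := by simp [extend]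
    _ = _ := by rw [← whisker_exchange]; simp [extend]

theorem extend {θ : a ≫ x ⟶ b ≫ y} {θ' : a' ≫ x ⟶ b' ≫ y} (h : Intertwines κ μ θ θ')
    (g : Y ⟶ Z) : Intertwines κ μ (extend θ g) (extend θ' g) :=
  intertwines_extend_iff.mpr (congrArg (· ▷ g) h)

theorem restrict {θ : a ≫ x ⟶ b ≫ y} {θ' : a' ≫ x ⟶ b' ≫ y} (h : Intertwines κ μ θ θ')
    (d : E' ⟶ E) : Intertwines (restrictIso d κ) (restrictIso d μ) θ θ' :=
  intertwines_restrictIso_iff.mpr (congrArg (d ◁ ·) h)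

theorem of_assoc {Y' : K} {y : T ⟶ Y'} {g : Y ⟶ Z} {h : Y' ⟶ Z}
    {θ : a ≫ x ≫ g ⟶ b ≫ y ≫ h} {θ' : a' ≫ x ≫ g ⟶ b' ≫ y ≫ h} (H : Intertwines κ μ θ θ') :
    Intertwines (extendIso κ x) (extendIso μ y) ((α_ a x g).hom ≫ θ ≫ (α_ b y h).inv)
      ((α_ a' x g).hom ≫ θ' ≫ (α_ b' y h).inv) := by
  calc
    _ = e ◁ (α_ a x g).hom ≫ (BiFrac.extend κ.hom (x ≫ g) ≫ e' ◁ θ') ≫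
        e' ◁ (α_ b' y h).inv := by
      simp only [extendIso_hom, BiFrac.extend]; bicategory
    _ = _ := by rw [H]; simp only [extendIso_hom, BiFrac.extend]; bicategory

end Intertwines
end Intertwines

/-! ### Morphisms that are fully faithful up to refinement -/

/-- Postcomposition with `x` is full on isomorphisms, and faithful, on 2-morphisms after restriction
along morphisms of `W`. -/
structure LocallyFullyFaithful (W : MorphismProperty K) {S Y : K} (x : S ⟶ Y) : Prop where
  full : ∀ {Q : K} (f₁ f₂ : Q ⟶ S) (α : f₁ ≫ x ≅ f₂ ≫ x), ∃ (E : K) (d : E ⟶ Q)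
    (β : d ≫ f₁ ≅ d ≫ f₂), W d ∧ d ◁ α.hom = extend β.hom x
  faithful : ∀ {Q : K} {f₁ f₂ : Q ⟶ S} (β β' : f₁ ⟶ f₂), β ▷ x = β' ▷ x →
    ∃ (E : K) (d : E ⟶ Q), W d ∧ d ◁ β = d ◁ β'

theorem CellLift.whiskerLeft_eq_extend {X Y Z : K} {u : Y ⟶ Z} {f₁ f₂ : X ⟶ Y}
    {α : f₁ ≫ u ⟶ f₂ ≫ u} (L : CellLift W u f₁ f₂ α) : L.v ◁ α = extend L.β u := by
  rw [L.fac]; unfold extend; bicategory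

theorem BF.locallyFullyFaithful_of_mem (hW : BF W) {S Y : K} {u : S ⟶ Y} (hu : W u) :
    LocallyFullyFaithful W u where
  full f₁ f₂ α := by
    obtain ⟨L, hL⟩ := hW.bf4ab u hu f₁ f₂ α.hom
    have := hL inferInstance
    exact ⟨L.pt, L.v, asIso L.β, L.v_mem, L.whiskerLeft_eq_extend⟩
  faithful {Q f₁ f₂} β β' h := by
    -- Both `β` and `β'` are lifts of `β ▷ u`, so (BF4c) compares them.
    obtain ⟨E, t, t', ζ, hm, hζ⟩ := hW.bf4c u hu f₁ f₂ (β ▷ u)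
      ⟨Q, 𝟙 Q, hW.bf1 Q, 𝟙 Q ◁ β, by bicategory⟩
      ⟨Q, 𝟙 Q, hW.bf1 Q, 𝟙 Q ◁ β', by rw [h]; bicategory⟩
    refine ⟨E, t ≫ 𝟙 Q, hm, ?_⟩
    rw [← cancel_mono (ζ.hom ▷ f₂), whisker_exchange _ β']
    calc
      _ = 𝟙 ((t ≫ 𝟙 Q) ≫ f₁) ⊗≫ t ◁ (𝟙 Q ◁ β) ⊗≫ ζ.hom ▷ f₂ := by bicategory
      _ = _ := by rw [← hζ]; bicategory

namespace LocallyFullyFaithful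

theorem of_comp (hW : BF W) {S Y Z : K} {x : S ⟶ Y} {y : Y ⟶ Z}
    (hxy : LocallyFullyFaithful W (x ≫ y)) (hy : LocallyFullyFaithful W y) :
    LocallyFullyFaithful W x where
  full {Q} f₁ f₂ α := by
    obtain ⟨E, d, β, hd, hβ⟩ := hxy.full f₁ f₂ (extendIso α y)
    obtain ⟨E', d', hd', h⟩ := hy.faithful (extend β.hom x) (d ◁ α.hom) (by
      calc
        _ = (α_ d (f₁ ≫ x) y).hom ≫ d ◁ (α_ f₁ x y).hom ≫ extend β.hom (x ≫ y) ≫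
            d ◁ (α_ f₂ x y).inv ≫ (α_ d (f₂ ≫ x) y).inv := by unfold extend; bicategory
        _ = _ := by rw [← hβ, extendIso_hom]; unfold extend; bicategory)
    refine ⟨E', d' ≫ d, restrictIso d' β, hW.bf2 _ _ hd' hd, ?_⟩
    rw [extend_restrictIso_hom, h, comp_whiskerLeft]
  faithful β β' h := hxy.faithful β β' (by rw [whiskerRight_comp, whiskerRight_comp, h])

theorem exists_refinement (hW : BF W) {X X' Z Y : K} {u : Z ⟶ Y} (hu : LocallyFullyFaithful W u)
    {x : X ⟶ Z} {x' : X' ⟶ Z} (hx' : W (x' ≫ u)) :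
    ∃ (E : K) (e : E ⟶ X) (e' : E ⟶ X') (_ : e ≫ x ≅ e' ≫ x'), W e := by
  obtain ⟨q⟩ := hW.bf3 (x ≫ u) (x' ≫ u) hx'
  obtain ⟨E, d, β, hd, -⟩ := hu.full (q.fst ≫ x) (q.snd ≫ x')
    (α_ _ _ _ ≪≫ q.iso ≪≫ (α_ _ _ _).symm)
  exact ⟨E, d ≫ q.fst, d ≫ q.snd, α_ _ _ _ ≪≫ β ≪≫ (α_ _ _ _).symm, hW.bf2 _ _ hd q.fst_mem⟩

section Intertwines

variable {E Q Q' S T Y Z : K} {e : E ⟶ Q} {e' : E ⟶ Q'} {a : Q ⟶ S} {a' : Q' ⟶ S} {b : Q ⟶ T}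
  {b' : Q' ⟶ T} {x : S ⟶ Y} {y : T ⟶ Y}

theorem exists_intertwines (hy : LocallyFullyFaithful W y) (κ : e ≫ a ≅ e' ≫ a')
    (θ : a ≫ x ≅ b ≫ y) (θ' : a' ≫ x ≅ b' ≫ y) :
    ∃ (E' : K) (d : E' ⟶ E) (μ : (d ≫ e) ≫ b ≅ (d ≫ e') ≫ b'), W d ∧
      Intertwines (restrictIso d κ) μ θ.hom θ'.hom := by
  obtain ⟨E', d, β, hd, h⟩ := hy.full (e ≫ b) (e' ≫ b') (α_ e b y ≪≫ whiskerLeftIso e θ.symm ≪≫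
    extendIso κ x ≪≫ whiskerLeftIso e' θ' ≪≫ (α_ e' b' y).symm)
  refine ⟨E', d, α_ d e b ≪≫ β ≪≫ (α_ d e' b').symm, hd, ?_⟩
  simp only [Iso.trans_hom, whiskerLeftIso_hom, Iso.symm_hom, extendIso_hom] at h
  rw [Intertwines, ← cancel_epi ((d ≫ e) ◁ θ.inv), whiskerLeft_inv_hom_assoc]
  calc
    _ = (α_ d e (b ≫ y)).hom ≫ d ◁ (α_ e b y).inv ≫ (d ◁ ((α_ e b y).hom ≫ e ◁ θ.inv ≫
        extend κ.hom x ≫ e' ◁ θ'.hom ≫ (α_ e' b' y).inv)) ≫ d ◁ (α_ e' b' y).hom ≫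
        (α_ d e' (b' ≫ y)).inv := by
      rw [extend_restrictIso_hom]; bicategory
    _ = _ := by rw [h]; simp only [extend, Iso.trans_hom, Iso.symm_hom]; bicategory

theorem exists_intertwines_of_extend {w : Y ⟶ Z} (hw : LocallyFullyFaithful W w)
    {κ : e ≫ a ≅ e' ≫ a'} {μ : e ≫ b ≅ e' ≫ b'} {θ : a ≫ x ⟶ b ≫ y} {θ' : a' ≫ x ⟶ b' ≫ y}
    (h : Intertwines κ μ (extend θ w) (extend θ' w)) :
    ∃ (E' : K) (d : E' ⟶ E), W d ∧ Intertwines (restrictIso d κ) (restrictIso d μ) θ θ' := by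
  obtain ⟨E', d, hd, hβ⟩ := hw.faithful _ _ (intertwines_extend_iff.mp h)
  exact ⟨E', d, hd, intertwines_restrictIso_iff.mpr hβ⟩

end Intertwines
end LocallyFullyFaithful

/-! ### Representatives of 2-morphisms -/

namespace Rep

variable {A B : K} {F₁ F₂ : Frac W A B}

theorem locallyFullyFaithful₁ (hW : BF W) (r : Rep F₁ F₂) : LocallyFullyFaithful W r.v₁ :=
  .of_comp hW (hW.locallyFullyFaithful_of_mem r.mem) (hW.locallyFullyFaithful_of_mem F₁.w_mem)

theorem cell_eq_of_intertwines (hW : BF W) {r r' : Rep F₁ F₂} {E : K} {e : E ⟶ r.pt}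
    {e' : E ⟶ r'.pt} (he : W e) {κ : e ≫ r.v₁ ≅ e' ≫ r'.v₁} {μ : e ≫ r.v₂ ≅ e' ≫ r'.v₂}
    (hα : Intertwines κ μ r.α.hom r'.α.hom) (hβ : Intertwines κ μ r.β r'.β) :
    r.cell = r'.cell :=
  Quot.sound ⟨E, e, e', κ.symm, μ, hW.bf2 _ _ he r.mem, intertwines_iff.mp hα,
    intertwines_iff.mp hβ⟩

/-- The restriction of a representative along a morphism `z` into its apex. -/
abbrev restrict (r : Rep F₁ F₂) {E : K} (z : E ⟶ r.pt) (hz : W ((z ≫ r.v₁) ≫ F₁.w)) :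
    Rep F₁ F₂ where
  pt := E
  v₁ := z ≫ r.v₁
  v₂ := z ≫ r.v₂
  α := restrictIso z r.α
  β := (α_ z r.v₁ F₁.f).hom ≫ z ◁ r.β ≫ (α_ z r.v₂ F₂.f).inv
  mem := hz

/-- A morphism of representatives: `r` is isomorphic to the restriction of `s` along `z`. -/
structure Hom (r s : Rep F₁ F₂) where
  z : r.pt ⟶ s.pt
  τ₁ : r.v₁ ≅ z ≫ s.v₁
  τ₂ : r.v₂ ≅ z ≫ s.v₂
  α_comm : τ₁.hom ▷ F₁.w ≫ (α_ z s.v₁ F₁.w).hom ≫ z ◁ s.α.hom =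
    r.α.hom ≫ τ₂.hom ▷ F₂.w ≫ (α_ z s.v₂ F₂.w).hom
  β_comm : τ₁.hom ▷ F₁.f ≫ (α_ z s.v₁ F₁.f).hom ≫ z ◁ s.β =
    r.β ≫ τ₂.hom ▷ F₂.f ≫ (α_ z s.v₂ F₂.f).hom

/-- The restriction of a representative maps to it. -/
def restrictHom (r : Rep F₁ F₂) {E : K} (z : E ⟶ r.pt) (hz : W ((z ≫ r.v₁) ≫ F₁.w)) :
    (r.restrict z hz).Hom r where
  z := z
  τ₁ := Iso.refl (z ≫ r.v₁)
  τ₂ := Iso.refl (z ≫ r.v₂)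
  α_comm := by simp
  β_comm := by simp

/-- The identity of a representative. -/
def Hom.refl (r : Rep F₁ F₂) : r.Hom r where
  z := 𝟙 r.pt
  τ₁ := (λ_ r.v₁).symm
  τ₂ := (λ_ r.v₂).symm
  α_comm := by simp
  β_comm := by simp

theorem Rel.exists_hom (hW : BF W) {r r' : Rep F₁ F₂} (h : r.Rel r') :
    ∃ q : Rep F₁ F₂, Nonempty (q.Hom r) ∧ Nonempty (q.Hom r') := by
  obtain ⟨E, z, z', σ₁, σ₂, hz, hα, hβ⟩ := h
  have comm : ∀ {Y : K} {x : F₁.pt ⟶ Y} {y : F₂.pt ⟶ Y} {θ : r.v₁ ≫ x ⟶ r.v₂ ≫ y}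
      {θ' : r'.v₁ ≫ x ⟶ r'.v₂ ≫ y}, σ₁.hom ▷ x ⊗≫ z ◁ θ ⊗≫ σ₂.hom ▷ y =
        𝟙 ((z' ≫ r'.v₁) ≫ x) ⊗≫ z' ◁ θ' ⊗≫ 𝟙 ((z' ≫ r'.v₂) ≫ y) →
      σ₁.symm.hom ▷ x ≫ (α_ z' r'.v₁ x).hom ≫ z' ◁ θ' =
        ((α_ z r.v₁ x).hom ≫ z ◁ θ ≫ (α_ z r.v₂ y).inv) ≫ σ₂.hom ▷ y ≫ (α_ z' r'.v₂ y).hom := by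
    intro Y x y θ θ' h
    have := (intertwines_iff (κ := σ₁.symm) (μ := σ₂)).mpr h
    simpa [Intertwines, extend] using (α_ z r.v₁ x).hom ≫= this
  have hz' := hW.mem_of_iso (α_ z r.v₁ F₁.w) hz
  exact ⟨r.restrict z hz', ⟨r.restrictHom z hz'⟩, ⟨⟨z', σ₁.symm, σ₂, comm hα, comm hβ⟩⟩⟩

/-- The comparison of the restrictions to `E` of the first legs of `r` and `s`. -/
def Hom.τ₁Restrict {r s : Rep F₁ F₂} (m : r.Hom s) {E : K} (k : E ⟶ r.pt) :
    k ≫ r.v₁ ≅ (k ≫ m.z) ≫ s.v₁ :=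
  whiskerLeftIso k m.τ₁ ≪≫ (α_ k m.z s.v₁).symm

/-- The comparison of the restrictions to `E` of the second legs of `r` and `s`. -/
def Hom.τ₂Restrict {r s : Rep F₁ F₂} (m : r.Hom s) {E : K} (k : E ⟶ r.pt) :
    k ≫ r.v₂ ≅ (k ≫ m.z) ≫ s.v₂ :=
  whiskerLeftIso k m.τ₂ ≪≫ (α_ k m.z s.v₂).symm

theorem Hom.extend_τ₁Restrict {r s : Rep F₁ F₂} (m : r.Hom s) {Y : K} {x : F₁.pt ⟶ Y}
    {y : F₂.pt ⟶ Y} {θ : r.v₁ ≫ x ⟶ r.v₂ ≫ y} {θ' : s.v₁ ≫ x ⟶ s.v₂ ≫ y}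
    (h : m.τ₁.hom ▷ x ≫ (α_ m.z s.v₁ x).hom ≫ m.z ◁ θ' =
      θ ≫ m.τ₂.hom ▷ y ≫ (α_ m.z s.v₂ y).hom) {E : K} (k : E ⟶ r.pt) :
    extend (m.τ₁Restrict k).hom x ≫ (k ≫ m.z) ◁ θ' =
      k ◁ θ ≫ extend (m.τ₂Restrict k).hom y := by
  have := congrArg (k ◁ · ≫ (α_ k m.z (s.v₂ ≫ y)).inv) h
  simpa [τ₁Restrict, τ₂Restrict, extend] using this

theorem cell_eq_of_iso (hW : BF W) {P : K} {v₁ v₁' : P ⟶ F₁.pt} {v₂ v₂' : P ⟶ F₂.pt}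
    {α : v₁ ≫ F₁.w ≅ v₂ ≫ F₂.w} {α' : v₁' ≫ F₁.w ≅ v₂' ≫ F₂.w} {β : v₁ ≫ F₁.f ⟶ v₂ ≫ F₂.f}
    {β' : v₁' ≫ F₁.f ⟶ v₂' ≫ F₂.f} {h : W (v₁ ≫ F₁.w)} {h' : W (v₁' ≫ F₁.w)}
    (τ₁ : v₁ ≅ v₁') (τ₂ : v₂ ≅ v₂')
    (hα : τ₁.hom ▷ F₁.w ≫ α'.hom = α.hom ≫ τ₂.hom ▷ F₂.w)
    (hβ : τ₁.hom ▷ F₁.f ≫ β' = β ≫ τ₂.hom ▷ F₂.f) :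
    (Rep.mk P v₁ v₂ α β h).cell = (Rep.mk P v₁' v₂' α' β' h').cell := by
  refine cell_eq_of_intertwines hW (e := 𝟙 P) (e' := 𝟙 P) (hW.bf1 P)
    (κ := whiskerLeftIso _ τ₁) (μ := whiskerLeftIso _ τ₂) ?_ ?_
  · simp only [Intertwines, whiskerLeftIso_hom, extend_whiskerLeft,
      ← Bicategory.whiskerLeft_comp, hα]
  · simp only [Intertwines, whiskerLeftIso_hom, extend_whiskerLeft,
      ← Bicategory.whiskerLeft_comp, hβ]

theorem cell_congr {P : K} {v₁ : P ⟶ F₁.pt} {v₂ : P ⟶ F₂.pt} {α α' : v₁ ≫ F₁.w ≅ v₂ ≫ F₂.w}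
    {β β' : v₁ ≫ F₁.f ⟶ v₂ ≫ F₂.f} {h : W (v₁ ≫ F₁.w)} (hα : α.hom = α'.hom) (hβ : β = β') :
    (Rep.mk P v₁ v₂ α β h).cell = (Rep.mk P v₁ v₂ α' β' h).cell := by
  rw [Iso.ext hα, hβ]

end Rep

/-! ### Vertical composition -/

namespace VertFilling

variable {A B : K} {F₁ F₂ F₃ : Frac W A B} {r r' : Rep F₁ F₂} {s s' : Rep F₂ F₃}

theorem rep_α (P : VertFilling r s) : P.rep.α.hom = (α_ P.t₁ r.v₁ F₁.w).hom ≫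
    (P.t₁ ◁ r.α.hom ≫ extend P.ρ.hom F₂.w ≫ P.t₂ ◁ s.α.hom) ≫ (α_ P.t₂ s.v₂ F₃.w).inv := by
  simp only [VertFilling.rep, bicategoricalIsoComp, Iso.trans_hom, Iso.refl_hom,
    whiskerLeftIso_hom, whiskerRightIso_hom, extend]
  bicategory

theorem rep_β (P : VertFilling r s) : P.rep.β = (α_ P.t₁ r.v₁ F₁.f).hom ≫
    (P.t₁ ◁ r.β ≫ extend P.ρ.hom F₂.f ≫ P.t₂ ◁ s.β) ≫ (α_ P.t₂ s.v₂ F₃.f).inv := by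
  simp only [VertFilling.rep, extend]
  bicategory

theorem cell_eq (hW : BF W) (P P' : VertFilling r s) : P.rep.cell = P'.rep.cell := by
  obtain ⟨E, e, e', κ, he⟩ := (hW.locallyFullyFaithful_of_mem r.mem).exists_refinement hW
    (x := P.t₁) (x' := P'.t₁) (hW.mem_of_iso (α_ _ _ _).symm P'.mem)
  obtain ⟨E', d, μ, hd, hρ⟩ := (s.locallyFullyFaithful₁ hW).exists_intertwines κ P.ρ P'.ρ
  have pasting : ∀ {Y : K} {x : F₁.pt ⟶ Y} {y : F₂.pt ⟶ Y} {z : F₃.pt ⟶ Y}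
      (θ : r.v₁ ≫ x ⟶ r.v₂ ≫ y) (χ : s.v₁ ≫ y ⟶ s.v₂ ≫ z), Intertwines (restrictIso d κ) μ
        (P.t₁ ◁ θ ≫ extend P.ρ.hom y ≫ P.t₂ ◁ χ) (P'.t₁ ◁ θ ≫ extend P'.ρ.hom y ≫ P'.t₂ ◁ χ) :=
    fun θ χ ↦ .comp (.whiskerLeft _ θ) (.comp (hρ.extend _) (.whiskerLeft _ χ))
  refine Rep.cell_eq_of_intertwines hW (r := P.rep) (r' := P'.rep) (hW.bf2 _ _ hd he)
    (κ := extendIso (restrictIso d κ) r.v₁) (μ := extendIso μ s.v₂) ?_ ?_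
  · rw [rep_α, rep_α]; exact (pasting r.α.hom s.α.hom).of_assoc
  · rw [rep_β, rep_β]; exact (pasting r.β s.β).of_assoc

/-- The image of a filling under morphisms of representatives. -/
def map (hW : BF W) (m : r.Hom r') (n : s.Hom s') (P : VertFilling r s) : VertFilling r' s' where
  pt := P.pt
  t₁ := P.t₁ ≫ m.z
  t₂ := P.t₂ ≫ n.z
  ρ := (m.τ₂Restrict P.t₁).symm ≪≫ P.ρ ≪≫ n.τ₁Restrict P.t₂
  mem := hW.mem_of_iso (whiskerRightIso (m.τ₁Restrict P.t₁).symm _) P.mem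

theorem cell_map (hW : BF W) (m : r.Hom r') (n : s.Hom s') (P : VertFilling r s) :
    (P.map hW m n).rep.cell = P.rep.cell := by
  have pasting : ∀ {Y : K} {x : F₁.pt ⟶ Y} {y : F₂.pt ⟶ Y} {z : F₃.pt ⟶ Y}
      {θ : r.v₁ ≫ x ⟶ r.v₂ ≫ y} {θ' : r'.v₁ ≫ x ⟶ r'.v₂ ≫ y}
      {χ : s.v₁ ≫ y ⟶ s.v₂ ≫ z} {χ' : s'.v₁ ≫ y ⟶ s'.v₂ ≫ z},
      (extend (m.τ₁Restrict P.t₁).hom x ≫ (P.t₁ ≫ m.z) ◁ θ' =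
        P.t₁ ◁ θ ≫ extend (m.τ₂Restrict P.t₁).hom y) →
      (extend (n.τ₁Restrict P.t₂).hom y ≫ (P.t₂ ≫ n.z) ◁ χ' =
        P.t₂ ◁ χ ≫ extend (n.τ₂Restrict P.t₂).hom z) →
      (m.τ₁Restrict P.t₁).hom ▷ x ≫ (α_ (P.t₁ ≫ m.z) r'.v₁ x).hom ≫
          ((P.t₁ ≫ m.z) ◁ θ' ≫ extend (P.map hW m n).ρ.hom y ≫ (P.t₂ ≫ n.z) ◁ χ') ≫
          (α_ (P.t₂ ≫ n.z) s'.v₂ z).inv =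
        ((α_ P.t₁ r.v₁ x).hom ≫ (P.t₁ ◁ θ ≫ extend P.ρ.hom y ≫ P.t₂ ◁ χ) ≫
          (α_ P.t₂ s.v₂ z).inv) ≫ (n.τ₂Restrict P.t₂).hom ▷ z := by
    intro Y x y z θ θ' χ χ' hm hn
    simp only [map, Iso.trans_hom, Iso.symm_hom, extend_comp, whiskerRight_eq_extend,
      Category.assoc, Iso.inv_hom_id_assoc, reassoc_of% hm, reassoc_of% hn, extend_hom_inv_assoc]
  refine (Rep.cell_eq_of_iso hW (m.τ₁Restrict P.t₁) (n.τ₂Restrict P.t₂) ?_ ?_).symm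
  · change _ ≫ (P.map hW m n).rep.α.hom = P.rep.α.hom ≫ _
    rw [rep_α, rep_α]
    exact pasting (m.extend_τ₁Restrict m.α_comm _) (n.extend_τ₁Restrict n.α_comm _)
  · change _ ≫ (P.map hW m n).rep.β = P.rep.β ≫ _
    rw [rep_β, rep_β]
    exact pasting (m.extend_τ₁Restrict m.β_comm _) (n.extend_τ₁Restrict n.β_comm _)

theorem cell_eq_of_hom (hW : BF W) (m : r.Hom r') (n : s.Hom s') (P : VertFilling r s)
    (P' : VertFilling r' s') : P.rep.cell = P'.rep.cell :=
  (cell_map hW m n P).symm.trans (cell_eq hW _ _)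

end VertFilling

/-! ### Associators -/

namespace AssocFilling

variable {hW : BF W} {C : CChoices W} {X Y Z T : K} {F : Frac W X Y} {G : Frac W Y Z}
  {H : Frac W Z T}

theorem rep_α (P : AssocFilling hW C F G H) : P.rep.α.hom =
    P.u₄ ◁ (α_ (C.sqL F G H).fst (C.sq F G).fst F.w).inv ≫ extend P.γ.hom F.w := by
  simp only [AssocFilling.rep, bicategoricalIsoComp, Iso.trans_hom, Iso.refl_hom,
    whiskerRightIso_hom, extend]
  bicategory

theorem rep_β (P : AssocFilling hW C F G H) : P.rep.β =
    extend P.ρ.hom H.f ≫ P.u₅ ◁ (α_ (C.sqR hW F G H).snd (C.sq G H).snd H.f).hom := by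
  simp only [AssocFilling.rep, extend]
  bicategory

theorem Valid.extend_ω {P : AssocFilling hW C F G H} (hP : P.Valid) : extend P.ω.hom G.w =
    P.u₄ ◁ ((α_ (C.sqL F G H).fst (C.sq F G).snd G.w).hom ≫
        (C.sqL F G H).fst ◁ (C.sq F G).iso.inv ≫
        (α_ (C.sqL F G H).fst (C.sq F G).fst F.f).inv) ≫
      extend P.γ.hom F.f ≫
      P.u₅ ◁ ((C.sqR hW F G H).iso.hom ≫
        (α_ (C.sqR hW F G H).snd (C.sq G H).fst G.w).inv) := by
  unfold extend
  rw [hP.ω_eq]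
  bicategory

theorem Valid.extend_ρ {P : AssocFilling hW C F G H} (hP : P.Valid) : extend P.ρ.hom H.w =
    P.u₄ ◁ ((C.sqL F G H).iso.inv ≫ (α_ (C.sqL F G H).fst (C.sq F G).snd G.f).inv) ≫
      extend P.ω.hom G.f ≫
      P.u₅ ◁ ((α_ (C.sqR hW F G H).snd (C.sq G H).fst G.f).hom ≫
        (C.sqR hW F G H).snd ◁ (C.sq G H).iso.hom ≫
        (α_ (C.sqR hW F G H).snd (C.sq G H).snd H.w).inv) := by
  unfold extend
  rw [hP.ρ_eq]
  bicategory

theorem cell_eq {P P' : AssocFilling hW C F G H} (hP : P.Valid) (hP' : P'.Valid) :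
    P.rep.cell = P'.rep.cell := by
  obtain ⟨E₁, e, e', κ, he⟩ := (hW.locallyFullyFaithful_of_mem
    (compFrac hW C (compFrac hW C F G) H).w_mem).exists_refinement hW
    (x := P.u₄) (x' := P'.u₄) P'.mem
  obtain ⟨E₂, d, μ, hd, hγ⟩ := (hW.locallyFullyFaithful_of_mem
    (C.sqR hW F G H).fst_mem).exists_intertwines κ P.γ P'.γ
  have hωG : Intertwines (restrictIso d κ) μ (extend P.ω.hom G.w) (extend P'.ω.hom G.w) := by
    rw [hP.extend_ω, hP'.extend_ω]
    exact .comp (.whiskerLeft _ _) (.comp (hγ.extend _) (.whiskerLeft _ _))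
  obtain ⟨E₃, d', hd', hω⟩ :=
    (hW.locallyFullyFaithful_of_mem G.w_mem).exists_intertwines_of_extend hωG
  have hρH : Intertwines (restrictIso d' (restrictIso d κ)) (restrictIso d' μ)
      (extend P.ρ.hom H.w) (extend P'.ρ.hom H.w) := by
    rw [hP.extend_ρ, hP'.extend_ρ]
    exact .comp (.whiskerLeft _ _) (.comp (hω.extend _) (.whiskerLeft _ _))
  obtain ⟨E₄, d'', hd'', hρ⟩ :=
    (hW.locallyFullyFaithful_of_mem H.w_mem).exists_intertwines_of_extend hρH
  refine Rep.cell_eq_of_intertwines hW (r := P.rep) (r' := P'.rep)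
    (hW.bf2 _ _ hd'' (hW.bf2 _ _ hd' (hW.bf2 _ _ hd he)))
    (κ := restrictIso d'' (restrictIso d' (restrictIso d κ)))
    (μ := restrictIso d'' (restrictIso d' μ)) ?_ ?_
  · rw [rep_α, rep_α]
    exact .comp (.whiskerLeft _ _) (((hγ.restrict d').restrict d'').extend F.w)
  · rw [rep_β, rep_β]
    exact .comp (hρ.extend H.f) (.whiskerLeft _ _)

theorem valid_ofLifts
    (q : OreSquare W ((C.sqL F G H).fst ≫ (C.sq F G).fst) (C.sqR hW F G H).fst)
    (L : CellLift W G.w (q.fst ≫ (C.sqL F G H).fst ≫ (C.sq F G).snd)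
      (q.snd ≫ (C.sqR hW F G H).snd ≫ (C.sq G H).fst) (assocPasting₁ q).hom)
    (hL : IsIso L.β)
    (M : CellLift W H.w (L.v ≫ q.fst ≫ (C.sqL F G H).snd)
      (L.v ≫ q.snd ≫ (C.sqR hW F G H).snd ≫ (C.sq G H).snd)
      (assocPasting₂ q L.v (L.isoβ hL)).hom)
    (hM : IsIso M.β) : (ofLifts q L hL M hM).Valid := by
  constructor <;>
    simp only [ofLifts, bicategoricalIsoComp, Iso.trans_hom, Iso.refl_hom, whiskerLeftIso_hom,
      asIso_hom]
  · calc
      _ = 𝟙 _ ⊗≫ M.v ◁ extend L.β G.w ⊗≫ 𝟙 _ := by unfold extend; bicategory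
      _ = 𝟙 _ ⊗≫ M.v ◁ L.v ◁ (assocPasting₁ q).hom ⊗≫ 𝟙 _ :=
        congrArg (fun t ↦ 𝟙 _ ⊗≫ M.v ◁ t ⊗≫ 𝟙 _) L.whiskerLeft_eq_extend.symm
      _ = _ := by
        simp only [assocPasting₁, bicategoricalIsoComp, Iso.trans_hom, Iso.refl_hom,
          whiskerLeftIso_hom, whiskerRightIso_hom, Iso.symm_hom]
        bicategory
  · calc
      _ = 𝟙 _ ⊗≫ extend M.β H.w ⊗≫ 𝟙 _ := by unfold extend; bicategory
      _ = 𝟙 _ ⊗≫ M.v ◁ (assocPasting₂ q L.v (L.isoβ hL)).hom ⊗≫ 𝟙 _ :=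
        congrArg (fun t ↦ 𝟙 _ ⊗≫ t ⊗≫ 𝟙 _) M.whiskerLeft_eq_extend.symm
      _ = _ := by
        simp only [assocPasting₂, bicategoricalIsoComp, Iso.trans_hom, Iso.refl_hom,
          whiskerLeftIso_hom, whiskerRightIso_hom, Iso.symm_hom, asIso_hom]
        bicategory

end AssocFilling

/-! ### Whiskering with a morphism that is composed first -/

/-- A valid filling for `Δ ∘ F` after restriction to its apex, where `k` is its second leg into the
source of `r`. The 2-morphism `δ`, which identifies the two legs, has been absorbed into `σ₁`. -/
structure ReducedLeftFilling (C : CChoices W) {X Y Z : K} (F : Frac W X Y) {G₁ G₂ : Frac W Y Z}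
    (r : Rep G₁ G₂) where
  pt : K
  a₁ : pt ⟶ (C.sq F G₁).pt
  a₂ : pt ⟶ (C.sq F G₂).pt
  k : pt ⟶ r.pt
  σ₁ : a₁ ≫ (C.sq F G₁).snd ≅ k ≫ r.v₁
  σ₂ : a₂ ≫ (C.sq F G₂).snd ≅ k ≫ r.v₂
  φ : a₁ ≫ (C.sq F G₁).fst ≅ a₂ ≫ (C.sq F G₂).fst
  mem : W (a₁ ≫ (C.sq F G₁).fst ≫ F.w)
  valid : extend σ₂.hom G₂.w = a₂ ◁ (C.sq F G₂).iso.inv ≫ extend φ.inv F.f ≫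
    a₁ ◁ (C.sq F G₁).iso.hom ≫ extend σ₁.hom G₁.w ≫ k ◁ r.α.hom

namespace ReducedLeftFilling

variable {C : CChoices W} {X Y Z : K} {F : Frac W X Y} {G₁ G₂ : Frac W Y Z} {r r' : Rep G₁ G₂}

/-- The representative of `Δ ∘ F` given by a reduced filling. -/
def rep (hW : BF W) (P : ReducedLeftFilling C F r) :
    Rep (compFrac hW C F G₁) (compFrac hW C F G₂) where
  pt := P.pt
  v₁ := P.a₁
  v₂ := P.a₂
  α := extendIso P.φ F.w
  β := extend P.σ₁.hom G₁.f ≫ P.k ◁ r.β ≫ extend P.σ₂.inv G₂.f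
  mem := P.mem

theorem cell_eq (hW : BF W) (P P' : ReducedLeftFilling C F r) :
    (P.rep hW).cell = (P'.rep hW).cell := by
  obtain ⟨E₁, e, e', κ, he⟩ := (hW.locallyFullyFaithful_of_mem
    (compFrac hW C F G₁).w_mem).exists_refinement hW (x := P.a₁) (x' := P'.a₁) P'.mem
  obtain ⟨E₂, d, μ, hd, hσ₁⟩ := (r.locallyFullyFaithful₁ hW).exists_intertwines κ P.σ₁ P'.σ₁
  obtain ⟨E₃, d', ν, hd', hφ⟩ := (hW.locallyFullyFaithful_of_mem
    (C.sq F G₂).fst_mem).exists_intertwines (restrictIso d κ) P.φ P'.φ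
  have hσ₂G : Intertwines ν (restrictIso d' μ) (extend P.σ₂.hom G₂.w)
      (extend P'.σ₂.hom G₂.w) := by
    rw [P.valid, P'.valid]
    exact .comp (.whiskerLeft _ _) (.comp (hφ.inv.extend _) (.comp (.whiskerLeft _ _)
      (.comp ((hσ₁.restrict d').extend _) (.whiskerLeft _ _))))
  obtain ⟨E₄, d'', hd'', hσ₂⟩ :=
    (hW.locallyFullyFaithful_of_mem G₂.w_mem).exists_intertwines_of_extend hσ₂G
  exact Rep.cell_eq_of_intertwines hW (r := P.rep hW) (r' := P'.rep hW)
    (hW.bf2 _ _ hd'' (hW.bf2 _ _ hd' (hW.bf2 _ _ hd he)))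
    ((hφ.restrict d'').extend F.w)
    (.comp (((hσ₁.restrict d').restrict d'').extend G₁.f)
      (.comp (.whiskerLeft _ _) (hσ₂.inv.extend G₂.f)))

/-- The image of a reduced filling under a morphism of representatives. -/
def map (m : r.Hom r') (P : ReducedLeftFilling C F r) : ReducedLeftFilling C F r' where
  pt := P.pt
  a₁ := P.a₁
  a₂ := P.a₂
  k := P.k ≫ m.z
  σ₁ := P.σ₁ ≪≫ m.τ₁Restrict P.k
  σ₂ := P.σ₂ ≪≫ m.τ₂Restrict P.k
  φ := P.φ
  mem := P.mem
  valid := by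
    simp only [Iso.trans_hom, extend_comp, Category.assoc, m.extend_τ₁Restrict m.α_comm, P.valid]

theorem cell_map (hW : BF W) (m : r.Hom r') (P : ReducedLeftFilling C F r) :
    ((P.map m).rep hW).cell = (P.rep hW).cell := by
  refine Rep.cell_congr rfl ?_
  change extend (P.σ₁ ≪≫ m.τ₁Restrict P.k).hom G₁.f ≫ (P.k ≫ m.z) ◁ r'.β ≫
      extend (P.σ₂ ≪≫ m.τ₂Restrict P.k).inv G₂.f =
    extend P.σ₁.hom G₁.f ≫ P.k ◁ r.β ≫ extend P.σ₂.inv G₂.f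
  simp only [Iso.trans_hom, Iso.trans_inv, extend_comp, Category.assoc,
    reassoc_of% m.extend_τ₁Restrict m.β_comm, extend_hom_inv_assoc]

/-- The reduction of a valid filling. -/
def ofFilling (P : LeftFilling C F r) (hP : P.Valid) : ReducedLeftFilling C F r where
  pt := P.D₅
  a₁ := P.t₃ ≫ P.t₁
  a₂ := P.t₄ ≫ P.t₂
  k := P.t₄ ≫ P.h₂
  σ₁ := restrictIso P.t₃ P.σ₁ ≪≫ whiskerRightIso P.δ r.v₁
  σ₂ := restrictIso P.t₄ P.σ₂
  φ := α_ _ _ _ ≪≫ P.φ ≪≫ (α_ _ _ _).symm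
  mem := P.mem
  valid := by
    have hσ₁ : extend (restrictIso P.t₃ P.σ₁ ≪≫ whiskerRightIso P.δ r.v₁).hom G₁.w =
        extend (restrictIso P.t₃ P.σ₁).hom G₁.w ≫ P.δ.hom ▷ (r.v₁ ≫ G₁.w) := by
      simp only [extend, Iso.trans_hom, whiskerRightIso_hom]; bicategory
    have hδ : P.δ.hom ▷ (r.v₁ ≫ G₁.w) = extend (restrictIso P.t₃ P.σ₁).inv G₁.w ≫
        (P.t₃ ≫ P.t₁) ◁ (C.sq F G₁).iso.inv ≫
        extend (α_ _ _ _ ≪≫ P.φ ≪≫ (α_ _ _ _).symm).hom F.f ≫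
        (P.t₄ ≫ P.t₂) ◁ (C.sq F G₂).iso.hom ≫ extend (restrictIso P.t₄ P.σ₂).hom G₂.w ≫
        (P.t₄ ≫ P.h₂) ◁ r.α.inv := by
      rw [hP]
      simp only [extend, restrictIso_hom, restrictIso_inv, Iso.trans_hom, Iso.symm_hom]
      bicategory
    rw [hσ₁, hδ]
    simp only [Category.assoc, extend_hom_inv_assoc, extend_inv_hom_assoc,
      whiskerLeft_hom_inv_assoc, whiskerLeft_inv_hom_assoc, whiskerLeft_inv_hom, Category.comp_id]

theorem cell_ofFilling (hW : BF W) (P : LeftFilling C F r) (hP : P.Valid) :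
    ((ofFilling P hP).rep hW).cell = (P.rep hW).cell := by
  refine Rep.cell_congr ?_ ?_
  · simp only [ofFilling, extendIso_hom, extend, bicategoricalIsoComp, Iso.trans_hom,
      Iso.refl_hom, Iso.symm_hom, whiskerRightIso_hom]
    bicategory
  · simp only [ofFilling, extend, restrictIso_hom, restrictIso_inv, Iso.trans_hom,
      whiskerRightIso_hom]
    bicategory

end ReducedLeftFilling

namespace LeftFilling

variable {C : CChoices W} {X Y Z : K} {F : Frac W X Y} {G₁ G₂ : Frac W Y Z} {r r' : Rep G₁ G₂}

theorem cell_eq_of_hom (hW : BF W) (m : r.Hom r') {P : LeftFilling C F r} (hP : P.Valid)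
    {P' : LeftFilling C F r'} (hP' : P'.Valid) : (P.rep hW).cell = (P'.rep hW).cell := by
  rw [← ReducedLeftFilling.cell_ofFilling hW P hP, ← ReducedLeftFilling.cell_ofFilling hW P' hP',
    ← ReducedLeftFilling.cell_map hW m]
  exact ReducedLeftFilling.cell_eq hW _ _

theorem valid_ofLift (hW : BF W) (m : HalfFilling C F G₁ r.v₁) (n : HalfFilling C F G₂ r.v₂)
    (q : OreSquare W (m.t ≫ (C.sq F G₁).fst) (n.t ≫ (C.sq F G₂).fst))
    (L : CellLift W (r.v₁ ≫ G₁.w) (q.fst ≫ m.h) (q.snd ≫ n.h) (leftPasting m n q).hom)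
    (hL : IsIso L.β) : (ofLift hW m n q L hL).Valid := by
  simp only [Valid, ofLift, bicategoricalIsoComp, Iso.trans_hom, Iso.refl_hom,
    whiskerLeftIso_hom, asIso_hom]
  calc
    _ = 𝟙 _ ⊗≫ extend L.β (r.v₁ ≫ G₁.w) ⊗≫ 𝟙 _ := by unfold extend; bicategory
    _ = 𝟙 _ ⊗≫ L.v ◁ (leftPasting m n q).hom ⊗≫ 𝟙 _ := by rw [L.whiskerLeft_eq_extend]
    _ = _ := by
      simp only [leftPasting, bicategoricalIsoComp, Iso.trans_hom, Iso.refl_hom,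
        whiskerLeftIso_hom, whiskerRightIso_hom, Iso.symm_hom]
      bicategory

end LeftFilling

/-! ### Whiskering with a morphism that is composed last -/

/-- A valid filling for `G ∘ Γ` after restriction to its apex, where `b` is its second leg into the
source of `r`. The 2-morphism `η₃`, which identifies the two legs, has been absorbed into `η₁`. -/
structure ReducedRightFilling (C : CChoices W) {X Y Z : K} {F₁ F₂ : Frac W X Y} (r : Rep F₁ F₂)
    (G : Frac W Y Z) where
  pt : K
  a₁ : pt ⟶ (C.sq F₁ G).pt
  a₂ : pt ⟶ (C.sq F₂ G).pt
  b : pt ⟶ r.pt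
  η₁ : b ≫ r.v₁ ≅ a₁ ≫ (C.sq F₁ G).fst
  η₂ : b ≫ r.v₂ ≅ a₂ ≫ (C.sq F₂ G).fst
  lam : a₁ ≫ (C.sq F₁ G).snd ⟶ a₂ ≫ (C.sq F₂ G).snd
  mem : W (a₁ ≫ (C.sq F₁ G).fst ≫ F₁.w)
  valid : extend lam G.w = a₁ ◁ (C.sq F₁ G).iso.inv ≫ extend η₁.inv F₁.f ≫ b ◁ r.β ≫
    extend η₂.hom F₂.f ≫ a₂ ◁ (C.sq F₂ G).iso.hom

namespace ReducedRightFilling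

variable {C : CChoices W} {X Y Z : K} {F₁ F₂ : Frac W X Y} {r r' : Rep F₁ F₂} {G : Frac W Y Z}

/-- The representative of `G ∘ Γ` given by a reduced filling. -/
def rep (hW : BF W) (P : ReducedRightFilling C r G) :
    Rep (compFrac hW C F₁ G) (compFrac hW C F₂ G) where
  pt := P.pt
  v₁ := P.a₁
  v₂ := P.a₂
  α := extendIso P.η₁.symm F₁.w ≪≫ whiskerLeftIso P.b r.α ≪≫ extendIso P.η₂ F₂.w
  β := extend P.lam G.f
  mem := P.mem

theorem cell_eq (hW : BF W) (P P' : ReducedRightFilling C r G) :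
    (P.rep hW).cell = (P'.rep hW).cell := by
  obtain ⟨E₁, e, e', κ, he⟩ := (hW.locallyFullyFaithful_of_mem
    (compFrac hW C F₁ G).w_mem).exists_refinement hW (x := P.a₁) (x' := P'.a₁) P'.mem
  obtain ⟨E₂, d, μ, hd, hη₁⟩ :=
    (r.locallyFullyFaithful₁ hW).exists_intertwines κ P.η₁.symm P'.η₁.symm
  obtain ⟨E₃, d', ν, hd', hη₂⟩ := (hW.locallyFullyFaithful_of_mem
    (C.sq F₂ G).fst_mem).exists_intertwines μ P.η₂ P'.η₂
  have hlamG : Intertwines (restrictIso d' (restrictIso d κ)) ν (extend P.lam G.w)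
      (extend P'.lam G.w) := by
    rw [P.valid, P'.valid]
    exact .comp (.whiskerLeft _ _) (.comp ((hη₁.restrict d').extend _)
      (.comp (.whiskerLeft _ _) (.comp (hη₂.extend _) (.whiskerLeft _ _))))
  obtain ⟨E₄, d'', hd'', hlam⟩ :=
    (hW.locallyFullyFaithful_of_mem G.w_mem).exists_intertwines_of_extend hlamG
  exact Rep.cell_eq_of_intertwines hW (r := P.rep hW) (r' := P'.rep hW)
    (hW.bf2 _ _ hd'' (hW.bf2 _ _ hd' (hW.bf2 _ _ hd he)))
    (.comp (((hη₁.restrict d').restrict d'').extend F₁.w)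
      (.comp (.whiskerLeft _ _) ((hη₂.restrict d'').extend F₂.w)))
    (hlam.extend G.f)

/-- The image of a reduced filling under a morphism of representatives. -/
def map (m : r.Hom r') (P : ReducedRightFilling C r G) : ReducedRightFilling C r' G where
  pt := P.pt
  a₁ := P.a₁
  a₂ := P.a₂
  b := P.b ≫ m.z
  η₁ := (m.τ₁Restrict P.b).symm ≪≫ P.η₁
  η₂ := (m.τ₂Restrict P.b).symm ≪≫ P.η₂
  lam := P.lam
  mem := P.mem
  valid := by
    simp only [Iso.trans_hom, Iso.trans_inv, Iso.symm_hom, Iso.symm_inv, extend_comp,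
      Category.assoc, reassoc_of% m.extend_τ₁Restrict m.β_comm, extend_hom_inv_assoc, P.valid]

theorem cell_map (hW : BF W) (m : r.Hom r') (P : ReducedRightFilling C r G) :
    ((P.map m).rep hW).cell = (P.rep hW).cell := by
  refine Rep.cell_congr ?_ rfl
  change extend ((m.τ₁Restrict P.b).symm ≪≫ P.η₁).inv F₁.w ≫ (P.b ≫ m.z) ◁ r'.α.hom ≫
      extend ((m.τ₂Restrict P.b).symm ≪≫ P.η₂).hom F₂.w =
    extend P.η₁.inv F₁.w ≫ P.b ◁ r.α.hom ≫ extend P.η₂.hom F₂.w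
  simp only [Iso.trans_hom, Iso.trans_inv, Iso.symm_hom, Iso.symm_inv, extend_comp,
    Category.assoc, reassoc_of% m.extend_τ₁Restrict m.α_comm, extend_hom_inv_assoc]

/-- The reduction of a valid filling. -/
def ofFilling (P : RightFilling C r G) (hP : P.Valid) : ReducedRightFilling C r G where
  pt := P.D₅
  a₁ := P.u₇ ≫ P.u₄
  a₂ := P.u₈ ≫ P.u₆
  b := P.u₈ ≫ P.u₅
  η₁ := whiskerRightIso P.η₃.symm r.v₁ ≪≫ restrictIso P.u₇ P.η₁
  η₂ := restrictIso P.u₈ P.η₂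
  lam := (α_ _ _ _).hom ≫ P.lam ≫ (α_ _ _ _).inv
  mem := P.mem
  valid := by
    calc
      _ = 𝟙 _ ⊗≫ P.lam ▷ G.w ⊗≫ 𝟙 _ := by unfold extend; bicategory
      _ = _ := by
        rw [hP]
        simp only [extend, restrictIso_hom, restrictIso_inv, Iso.trans_inv, Iso.symm_inv,
          whiskerRightIso_inv]
        bicategory

theorem cell_ofFilling (hW : BF W) (P : RightFilling C r G) (hP : P.Valid) :
    ((ofFilling P hP).rep hW).cell = (P.rep hW).cell := by
  refine Rep.cell_congr ?_ ?_
  · change extend (whiskerRightIso P.η₃.symm r.v₁ ≪≫ restrictIso P.u₇ P.η₁).inv F₁.w ≫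
      (P.u₈ ≫ P.u₅) ◁ r.α.hom ≫ extend (restrictIso P.u₈ P.η₂).hom F₂.w = _
    simp only [extend, restrictIso_hom, restrictIso_inv, bicategoricalIsoComp, Iso.trans_hom,
      Iso.refl_hom, Iso.trans_inv, Iso.symm_inv, Iso.symm_hom, whiskerLeftIso_hom,
      whiskerRightIso_hom, whiskerRightIso_inv]
    bicategory
  · simp only [ofFilling, extend]
    bicategory

end ReducedRightFilling

namespace RightFilling

variable {C : CChoices W} {X Y Z : K} {F₁ F₂ : Frac W X Y} {r r' : Rep F₁ F₂} {G : Frac W Y Z}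

theorem cell_eq_of_hom (hW : BF W) (m : r.Hom r') {P : RightFilling C r G} (hP : P.Valid)
    {P' : RightFilling C r' G} (hP' : P'.Valid) : (P.rep hW).cell = (P'.rep hW).cell := by
  rw [← ReducedRightFilling.cell_ofFilling hW P hP,
    ← ReducedRightFilling.cell_ofFilling hW P' hP', ← ReducedRightFilling.cell_map hW m]
  exact ReducedRightFilling.cell_eq hW _ _

theorem valid_ofLift (hW : BF W) (x₁ : OreSquare W r.v₁ (C.sq F₁ G).fst)
    (x₂ : OreSquare W r.v₂ (C.sq F₂ G).fst) (x₃ : OreSquare W x₁.fst x₂.fst)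
    (L : CellLift W G.w (x₃.fst ≫ x₁.snd ≫ (C.sq F₁ G).snd)
      (x₃.snd ≫ x₂.snd ≫ (C.sq F₂ G).snd) (rightPasting x₁ x₂ x₃)) :
    (ofLift hW x₁ x₂ x₃ L).Valid := by
  simp only [Valid, ofLift, bicategoricalIsoComp, Iso.trans_hom, Iso.refl_hom,
    whiskerLeftIso_hom]
  calc
    _ = 𝟙 _ ⊗≫ extend L.β G.w ⊗≫ 𝟙 _ := by unfold extend; bicategory
    _ = 𝟙 _ ⊗≫ L.v ◁ rightPasting x₁ x₂ x₃ ⊗≫ 𝟙 _ := by rw [L.whiskerLeft_eq_extend]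
    _ = _ := by unfold rightPasting; bicategory

end RightFilling

/-! ### The operations on 2-morphisms -/

namespace Cell

/-- The function on 2-morphisms induced by a function on representatives that is invariant under
morphisms of representatives. -/
def lift (hW : BF W) {A B : K} {F₁ F₂ : Frac W A B} {T : Sort*} (f : Rep F₁ F₂ → T)
    (hf : ∀ {r s : Rep F₁ F₂}, r.Hom s → f r = f s) : Cell F₁ F₂ → T :=
  Quot.lift f fun _ _ h ↦
    let ⟨_, ⟨m⟩, ⟨m'⟩⟩ := h.exists_hom hW
    (hf m).symm.trans (hf m')

variable (hW : BF W) (C : CChoices W) (D : DChoices W)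

/-- Vertical composition, computed with the choices `C(W)` and `D(W)`. -/
noncomputable def vcomp {X Y : K} {F₁ F₂ F₃ : Frac W X Y} :
    Cell F₁ F₂ → Cell F₂ F₃ → Cell F₁ F₃ :=
  lift hW (fun r ↦ lift hW (fun s ↦ (vertFilling hW C D r s).rep.cell)
      fun n ↦ VertFilling.cell_eq_of_hom hW (.refl r) n _ _)
    fun m ↦ funext <| Quot.ind fun s ↦ VertFilling.cell_eq_of_hom hW m (.refl s) _ _

/-- Whiskering with a morphism that is composed first, computed with the choices `C(W)` and
`D(W)`. -/
noncomputable def whiskerLeft {X Y Z : K} (F : Frac W X Y) {G₁ G₂ : Frac W Y Z} :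
    Cell G₁ G₂ → Cell (compFrac hW C F G₁) (compFrac hW C F G₂) :=
  lift hW (fun r ↦ ((leftFilling hW C D F r).rep hW).cell) fun m ↦
    LeftFilling.cell_eq_of_hom hW m (LeftFilling.valid_ofLift ..) (LeftFilling.valid_ofLift ..)

/-- Whiskering with a morphism that is composed last, computed with the choices `C(W)` and
`D(W)`. -/
noncomputable def whiskerRight {X Y Z : K} {F₁ F₂ : Frac W X Y} (Φ : Cell F₁ F₂)
    (G : Frac W Y Z) : Cell (compFrac hW C F₁ G) (compFrac hW C F₂ G) :=
  Φ.lift hW (fun r ↦ ((rightFilling hW C D r G).rep hW).cell) fun m ↦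
    RightFilling.cell_eq_of_hom hW m (RightFilling.valid_ofLift ..) (RightFilling.valid_ofLift ..)

end Cell

/-! ### The bicategory of fractions -/

/-- The choices `D(W)` provided by (BF4). -/
noncomputable def BF.dChoices (hW : BF W) : DChoices W where
  lift u hu f₁ f₂ α := (hW.bf4ab u hu f₁ f₂ α).choose
  isIso_lift u hu f₁ f₂ α := (hW.bf4ab u hu f₁ f₂ α).choose_spec

namespace Ops

/-- The operations of the bicategory of fractions, constructed with the choices `C(W)` and
`D(W)`. -/
noncomputable def construct (hW : BF W) (C : CChoices W) (D : DChoices W) : Ops hW C where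
  id₂ F := (idRep hW F).cell
  vcomp := Cell.vcomp hW C D
  whiskerLeft := Cell.whiskerLeft hW C D
  whiskerRight := Cell.whiskerRight hW C D
  hcomp {_ _ _ _ F₂ G₁ _} Φ Ψ :=
    Cell.vcomp hW C D (Cell.whiskerRight hW C D Φ G₁) (Cell.whiskerLeft hW C D F₂ Ψ)
  associator F G H := (assocFilling hW C D F G H).rep.cell
  leftUnitor F := (leftUnitorRep hW C F).cell
  rightUnitor F := (rightUnitorRep hW C F).cell

theorem isConstructed_construct (hW : BF W) (C : CChoices W) (D : DChoices W) :
    (construct hW C D).IsConstructed D := by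
  constructor <;> intros <;> rfl

namespace IsConstructed

variable {hW : BF W} {C : CChoices W} {S S' : Ops hW C} {D : DChoices W}

theorem isChoiceFree (h : S.IsConstructed D) : S.IsChoiceFree where
  vcomp_eq r s _ := (h.vcomp_eq r s).trans (VertFilling.cell_eq hW _ _)
  whiskerLeft_eq F _ _ r _ hP := (h.whiskerLeft_eq F r).trans
    (LeftFilling.cell_eq_of_hom hW (.refl r) (LeftFilling.valid_ofLift ..) hP)
  whiskerRight_eq r G _ hP := (h.whiskerRight_eq r G).trans
    (RightFilling.cell_eq_of_hom hW (.refl r) (RightFilling.valid_ofLift ..) hP)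
  associator_eq F G H _ hP :=
    (h.associator_eq F G H).trans (AssocFilling.cell_eq (AssocFilling.valid_ofLifts ..) hP)

theorem change_choices (h : S.IsConstructed D) (D' : DChoices W) : S.IsConstructed D' :=
  { h with
    vcomp_eq := fun r s ↦ h.isChoiceFree.vcomp_eq r s _
    whiskerLeft_eq := fun F _ _ r ↦
      h.isChoiceFree.whiskerLeft_eq F r _ (LeftFilling.valid_ofLift ..)
    whiskerRight_eq := fun r G ↦
      h.isChoiceFree.whiskerRight_eq r G _ (RightFilling.valid_ofLift ..)
    associator_eq := fun F G H ↦
      h.isChoiceFree.associator_eq F G H _ (AssocFilling.valid_ofLifts ..) }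

theorem unique (h : S.IsConstructed D) (h' : S'.IsConstructed D) : S = S' := by
  have vcomp : ∀ {X Y : K} {F₁ F₂ F₃ : Frac W X Y} (Φ : Cell F₁ F₂) (Ψ : Cell F₂ F₃),
      S.vcomp Φ Ψ = S'.vcomp Φ Ψ := by
    rintro X Y F₁ F₂ F₃ ⟨r⟩ ⟨s⟩
    exact (h.vcomp_eq r s).trans (h'.vcomp_eq r s).symm
  have whiskerLeft : ∀ {X Y Z : K} (F : Frac W X Y) {G₁ G₂ : Frac W Y Z} (Φ : Cell G₁ G₂),
      S.whiskerLeft F Φ = S'.whiskerLeft F Φ := by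
    rintro X Y Z F G₁ G₂ ⟨r⟩
    exact (h.whiskerLeft_eq F r).trans (h'.whiskerLeft_eq F r).symm
  have whiskerRight : ∀ {X Y Z : K} {F₁ F₂ : Frac W X Y} (Φ : Cell F₁ F₂) (G : Frac W Y Z),
      S.whiskerRight Φ G = S'.whiskerRight Φ G := by
    rintro X Y Z F₁ F₂ ⟨r⟩ G
    exact (h.whiskerRight_eq r G).trans (h'.whiskerRight_eq r G).symm
  ext
  · rw [h.id₂_eq, h'.id₂_eq]
  · exact vcomp _ _
  · exact whiskerLeft _ _
  · exact whiskerRight _ _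
  · rw [h.hcomp_eq, h'.hcomp_eq, vcomp, whiskerLeft, whiskerRight]
  · rw [h.associator_eq, h'.associator_eq]
  · rw [h.leftUnitor_eq, h'.leftUnitor_eq]
  · rw [h.rightUnitor_eq, h'.rightUnitor_eq]

end IsConstructed
end Ops
end BiFrac

theorem mainTheorem1 {K : Type u} [Bicategory.{w, v} K] (W : MorphismProperty K)
    (hW : BiFrac.BF W) (C : BiFrac.CChoices W) :
    ∃ S : BiFrac.Ops hW C,
      (∀ (D : BiFrac.DChoices W) (S' : BiFrac.Ops hW C), S'.IsConstructed D ↔ S' = S) ∧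
      S.IsChoiceFree := by
  have h := BiFrac.Ops.isConstructed_construct hW C hW.dChoices
  refine ⟨_, fun D S' ↦ ⟨fun h' ↦ h'.unique (h.change_choices D), ?_⟩, h.isChoiceFree⟩
  rintro rfl
  exact h.change_choices D
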